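/- Let $k>1$ and $N\ge 1$ be odd natural numbers and let $x\in\mathbb{C}$ with $\operatorname{Re}(x)>0$. For real numbers $a,b>0$ with $a+b>1$ and $z\in\mathbb{C}\setminus(-\infty,0]$ put $$\mathscr{F}_{a,b}(z):=\sum_{n=1}^{\infty}\frac{\psi(n^{b}z)-\log(n^{b}z)}{n^{a}},$$ where $\psi=\Gamma'/\Gamma$; logarithms and complex powers are principal, $\zeta$ is the Riemann zeta function and $\gamma$ is Euler's constant. Let $\sum''_{j}$ denote the sum over $j=-(N-1),-(N-3),\dots,N-3,N-1$. Then all the series $\mathscr{F}$ below converge absolutely, and $$\begin{aligned} &\sum_{j=-(N-1)}^{N-1}{}^{''}\exp\!\left(-\tfrac{i\pi(k-1)j}{2N}\right)\left\{\mathscr{F}_{\frac{N+k-1}{N},\frac1N}\!\left(i\left(\tfrac{2\pi}{x}\right)^{\frac1N}e^{\frac{i\pi j}{2N}}\right)+\mathscr{F}_{\frac{N+k-1}{N},\frac1N}\!\left(-i\left(\tfrac{2\pi}{x}\right)^{\frac1N}e^{\frac{i\pi j}{2N}}\right)\right\}\\ &=(-1)^{\frac{k+1}{2}}N\left(\tfrac{2\pi}{x}\right)^{\frac{k-1}{N}}\left\{\mathscr{F}_{k,N}\!\left(\tfrac{ix}{2\pi}\right)+\mathscr{F}_{k,N}\!\left(-\tfrac{ix}{2\pi}\right)+2\left(\left(\gamma-\log\tfrac{2\pi}{x}\right)\zeta(k)-N\zeta'(k)\right)+\mathscr{C}(k,N,x)\right\},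 \end{aligned}$$ where, if $\frac{1-k}{N}\neq-2\left\lfloor\frac{k}{2N}\right\rfloor$, $$\mathscr{C}(k,N,x):=\frac{\pi\,\zeta\!\left(\frac{N+k-1}{N}\right)}{N\sin\left(\frac{\pi}{2N}(1-k)\right)}\left(\tfrac{x}{2\pi}\right)^{\frac{k-1}{N}}+4\pi\sum_{j=1}^{\lfloor\frac{k}{2N}\rfloor}(-1)^j(2\pi)^{-2j-1}\zeta(k-2Nj)\zeta(2j+1)x^{2j},$$ and, if $\frac{1-k}{N}=-2\left\lfloor\frac{k}{2N}\right\rfloor$, $$\begin{aligned}\mathscr{C}(k,N,x):={}&\frac{2(-1)^{\frac{k-1}{2N}}}{N}\left(\tfrac{x}{2\pi}\right)^{\frac{k-1}{N}}\left[\left(N\gamma+\log\tfrac{2\pi}{x}\right)\zeta\!\left(1+\tfrac{k-1}{N}\right)-\zeta'\!\left(1+\tfrac{k-1}{N}\right)\right]\\ &+4\pi\sum_{j=1}^{\lfloor\frac{k}{2N}\rfloor-1}(-1)^j(2\pi)^{-2j-1}\zeta(k-2Nj)\zeta(2j+1)x^{2j}.\end{aligned}$$ -/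

import Mathlib

open Complex

/-- The `n`-th term (`n = 0, 1, 2, …` standing for the index `n + 1 = 1, 2, 3, …`) of the series
defining the extended higher Herglotz function:
`(ψ((n+1)^N x) - log((n+1)^N x)) / (n+1)^k`, with real parameters `k`, `N`,
the digamma function `ψ` and the principal branch of the logarithm. -/
noncomputable def extHerglotzTerm (k N : ℝ) (x : ℂ) (n : ℕ) : ℂ :=
  (digamma ((((n : ℝ) + 1) ^ N : ℝ) * x) - log ((((n : ℝ) + 1) ^ N : ℝ) * x)) /
    (((n : ℝ) + 1) ^ k : ℝ)

/-- The extended higher Herglotz function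
`𝓕_{k,N}(x) = ∑_{n ≥ 1} (ψ(n^N x) - log(n^N x)) / n^k`. -/
noncomputable def extHerglotz (k N : ℝ) (x : ℂ) : ℂ :=
  ∑' n : ℕ, extHerglotzTerm k N x n

/-- The sum of `f j` over the `N` integers `j = -(N-1), -(N-3), …, N-3, N-1`. -/
noncomputable def stepTwoSum (N : ℕ) (f : ℤ → ℂ) : ℂ :=
  ∑ m ∈ Finset.range N, f (2 * (m : ℤ) - ((N : ℤ) - 1))

/-- The finite sum
`4π ∑_{j=1}^{M} (-1)^j (2π)^{-2j-1} ζ(k - 2Nj) ζ(2j+1) x^{2j}`. -/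
noncomputable def herglotzZetaSum (k N : ℕ) (x : ℂ) (M : ℕ) : ℂ :=
  4 * (Real.pi : ℂ) * ∑ j ∈ Finset.Icc 1 M,
    (-1 : ℂ) ^ j * (2 * (Real.pi : ℂ)) ^ (-2 * (j : ℤ) - 1) *
      riemannZeta ((k : ℂ) - 2 * N * j) * riemannZeta (2 * (j : ℂ) + 1) * x ^ (2 * j)

/-- The quantity `𝓒(k, N, x)`. Here `k / (2 * N)` is division of natural numbers, that is,
`⌊k / (2N)⌋`. In the second case `(k - 1) / (2 * N)` is an exact quotient. -/
noncomputable def herglotzC (k N : ℕ) (x : ℂ) : ℂ :=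
  if (1 - (k : ℚ)) / (N : ℚ) ≠ -2 * ((k / (2 * N) : ℕ) : ℚ) then
    (Real.pi : ℂ) * riemannZeta (((N : ℂ) + k - 1) / N) /
        (N * sin ((Real.pi : ℂ) / (2 * N) * (1 - k))) *
        (x / (2 * (Real.pi : ℂ))) ^ (((k : ℂ) - 1) / N) +
      herglotzZetaSum k N x (k / (2 * N))
  else
    2 * (-1 : ℂ) ^ ((k - 1) / (2 * N)) / N *
        (x / (2 * (Real.pi : ℂ))) ^ (((k : ℂ) - 1) / N) *
        (((N : ℂ) * (Real.eulerMascheroniConstant : ℂ) + log (2 * (Real.pi : ℂ) / x)) *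
            riemannZeta (1 + ((k : ℂ) - 1) / N) -
          deriv riemannZeta (1 + ((k : ℂ) - 1) / N)) +
      herglotzZetaSum k N x (k / (2 * N) - 1)

/-- The point `(2π/x)^{1/N} e^{iπj/(2N)}` (principal branch of the `N`-th root). -/
noncomputable def herglotzPoint (N : ℕ) (x : ℂ) (j : ℤ) : ℂ :=
  (2 * (Real.pi : ℂ) / x) ^ ((1 : ℂ) / N) * exp (I * Real.pi * j / (2 * N))

/-! Both sides evaluate one absolutely convergent double series in the two possible orders. Put y =
x/(2π), k = 2p+1 and p = Nq+r with 1 ≤ r ≤ N. With t = n^N y/m, the series has terms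
(-t²)^{q+1}/(1+t²) · 1/(n^k m) over n, m ≥ 1.

The bridge is the partial fraction series ψ(iz) + ψ(-iz) - log(iz) - log(-iz) + 2γ + 2 log z = ∑_m
(2/m) z²/(m²+z²), valid for Re z > 0 (`hasSum_digammaPair`). Summing over m first, z = n^N y gives
t²/(1+t²). This differs from the kernel by a sign and the first q terms of a geometric series in
-t², and those terms produce the products ζ(2j+1)ζ(k-2Nj). The outcome is the pair of functions
𝓕_{k,N} with ζ(k) and ζ'(k) (`tsum_herglotzKernel`).

Summing over n first, partial fractions over the N-th roots of unity write the kernel, for fixed m,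
as a combination of N such series at the points m^{1/N}(2π/x)^{1/N}e^{iπj/(2N)}
(`sum_stepExp_partial_fraction`, `herglotzKernel_transform`). This gives the left side of the
theorem, plus the contribution of 2γ + 2 log z weighted by the p-th inverse powers of the roots
(`stepTwoSum_extHerglotz`). If N ∤ p these weights sum to zero, and only the arguments iπj/(2N)
survive, giving the 1/sin term of 𝓒. If N ∣ p the arguments cancel by symmetry and the γ, log and ζ'
terms remain. -/

open Filter Topology

/-! ### Partial fractions of the digamma function -/

theorem summable_inv_sub_inv_add (z : ℂ) :
    Summable fun m : ℕ => 1 / ((m : ℂ) + 1) - 1 / ((m : ℂ) + 1 + z) := by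
  have hs : Summable fun m : ℕ => 2 * ‖z‖ * (1 / ((m : ℝ) + 1) ^ 2) := by
    refine Summable.mul_left _ ?_
    exact_mod_cast (summable_nat_add_iff 1).2 (Real.summable_one_div_nat_pow.2 (by norm_num : 1 < 2))
  refine Summable.of_norm_bounded_eventually_nat hs ?_
  filter_upwards [eventually_ge_atTop ⌈2 * ‖z‖⌉₊] with m hm
  have hm' : 2 * ‖z‖ ≤ m := Nat.ceil_le.1 hm
  have h1 : ‖((m : ℂ) + 1)‖ = (m : ℝ) + 1 := by
    rw [show ((m : ℂ) + 1) = ((m + 1 : ℕ) : ℂ) by push_cast; ring, norm_natCast]; push_cast; ring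
  have h2 : ((m : ℝ) + 1) / 2 ≤ ‖(m : ℂ) + 1 + z‖ := by
    have := norm_sub_le ((m : ℂ) + 1 + z) z
    rw [add_sub_cancel_right, h1] at this
    linarith
  have h3 : (m : ℂ) + 1 ≠ 0 := by exact_mod_cast Nat.succ_ne_zero m
  have h4 : (m : ℂ) + 1 + z ≠ 0 := by
    rw [← norm_pos_iff]; exact lt_of_lt_of_le (by positivity) h2
  have h5 : 1 / ((m : ℂ) + 1) - 1 / ((m : ℂ) + 1 + z) =
      z / (((m : ℂ) + 1) * ((m : ℂ) + 1 + z)) := by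
    field_simp; ring
  rw [h5, norm_div, norm_mul, h1]
  calc ‖z‖ / (((m : ℝ) + 1) * ‖(m : ℂ) + 1 + z‖)
      ≤ ‖z‖ / (((m : ℝ) + 1) * (((m : ℝ) + 1) / 2)) := by gcongr
    _ = 2 * ‖z‖ * (1 / ((m : ℝ) + 1) ^ 2) := by field_simp

/-- The logarithm of the Weierstrass product of `Gamma (z + 1)`, up to the linear term. -/
theorem hasDerivAt_tsum_sub_log {z : ℂ} (hz : -(1 / 2) < z.re) :
    HasDerivAt (fun w : ℂ => ∑' m : ℕ, (w / ((m : ℂ) + 1) - log (1 + w / ((m : ℂ) + 1))))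
      (∑' m : ℕ, (1 / ((m : ℂ) + 1) - 1 / ((m : ℂ) + 1 + z))) z ∧
    Summable fun m : ℕ => z / ((m : ℂ) + 1) - log (1 + z / ((m : ℂ) + 1)) := by
  obtain ⟨R, hR⟩ : ∃ R : ℝ, R = ‖z‖ + 1 := ⟨_, rfl⟩
  -- The bound -1/2 keeps |m+1+w| ≥ (m+1)/2 for every m while leaving the base point 0, where every
  -- term vanishes, inside the open set. The ball bounds the numerator of the derivative.
  let t : Set ℂ := {w : ℂ | -(1 / 2) < w.re} ∩ Metric.ball 0 R
  have hto : IsOpen t := (isOpen_lt continuous_const continuous_re).inter Metric.isOpen_ball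
  have htc : IsPreconnected t :=
    ((convex_halfSpace_re_gt _).inter (convex_ball _ _)).isPreconnected
  have h0 : (0 : ℂ) ∈ t := ⟨by simp, by simp [hR]; positivity⟩
  have hzt : z ∈ t := ⟨hz, by simp [hR]⟩
  have hs : Summable fun m : ℕ => 2 * R * (1 / ((m : ℝ) + 1) ^ 2) := by
    refine Summable.mul_left _ ?_
    exact_mod_cast (summable_nat_add_iff 1).2 (Real.summable_one_div_nat_pow.2 (by norm_num : 1 < 2))
  have hre : ∀ (m : ℕ) (w : ℂ), w ∈ t → ((m : ℝ) + 1) / 2 ≤ ((m : ℂ) + 1 + w).re := by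
    intro m w hw
    have := hw.1
    simp only [Set.mem_ofPred_eq] at this
    simp only [add_re, natCast_re, one_re]
    have : (0 : ℝ) ≤ m := Nat.cast_nonneg m
    linarith
  have h3 : ∀ m : ℕ, (m : ℂ) + 1 ≠ 0 := fun m => by exact_mod_cast Nat.succ_ne_zero m
  have hne : ∀ (m : ℕ) (w : ℂ), w ∈ t → (m : ℂ) + 1 + w ≠ 0 := by
    intro m w hw h
    have := hre m w hw
    rw [h, zero_re] at this
    have : (0 : ℝ) ≤ m := Nat.cast_nonneg m
    linarith
  have hder : ∀ (m : ℕ) (w : ℂ), w ∈ t →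
      HasDerivAt (fun w : ℂ => w / ((m : ℂ) + 1) - log (1 + w / ((m : ℂ) + 1)))
        (1 / ((m : ℂ) + 1) - 1 / ((m : ℂ) + 1 + w)) w := by
    intro m w hw
    have hslit : 1 + w / ((m : ℂ) + 1) ∈ slitPlane := by
      left
      have h6 : 1 + w / ((m : ℂ) + 1) = (((m : ℝ) + 1)⁻¹ : ℝ) * ((m : ℂ) + 1 + w) := by
        have := h3 m
        push_cast; field_simp
      rw [h6, re_ofReal_mul]
      have h7 := hre m w hw
      have h8 : (0 : ℝ) < ((m : ℂ) + 1 + w).re := lt_of_lt_of_le (by positivity) h7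
      positivity
    have hd := (hasDerivAt_id w).div_const ((m : ℂ) + 1)
    refine (hd.sub ((hd.const_add 1).clog hslit)).congr_deriv ?_
    have := h3 m
    have := hne m w hw
    have h9 : 1 + w / ((m : ℂ) + 1) = ((m : ℂ) + 1 + w) / ((m : ℂ) + 1) := by field_simp
    simp only [id, h9]
    field_simp
  have hbd : ∀ (m : ℕ) (w : ℂ), w ∈ t →
      ‖1 / ((m : ℂ) + 1) - 1 / ((m : ℂ) + 1 + w)‖ ≤ 2 * R * (1 / ((m : ℝ) + 1) ^ 2) := by
    intro m w hw
    have h1 : ‖((m : ℂ) + 1)‖ = (m : ℝ) + 1 := by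
      rw [show ((m : ℂ) + 1) = ((m + 1 : ℕ) : ℂ) by push_cast; ring, norm_natCast]; push_cast; ring
    have h2 : ((m : ℝ) + 1) / 2 ≤ ‖(m : ℂ) + 1 + w‖ := (hre m w hw).trans (re_le_norm _)
    have := h3 m
    have := hne m w hw
    have h5 : 1 / ((m : ℂ) + 1) - 1 / ((m : ℂ) + 1 + w) =
        w / (((m : ℂ) + 1) * ((m : ℂ) + 1 + w)) := by
      field_simp; ring
    have hw2 : ‖w‖ ≤ R := (mem_ball_zero_iff.1 hw.2).le
    have hR0 : 0 ≤ R := (norm_nonneg w).trans hw2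
    rw [h5, norm_div, norm_mul, h1]
    calc ‖w‖ / (((m : ℝ) + 1) * ‖(m : ℂ) + 1 + w‖)
        ≤ R / (((m : ℝ) + 1) * (((m : ℝ) + 1) / 2)) := by gcongr
      _ = 2 * R * (1 / ((m : ℝ) + 1) ^ 2) := by field_simp
  have hz0 : Summable fun m : ℕ => (0 : ℂ) / ((m : ℂ) + 1) - log (1 + 0 / ((m : ℂ) + 1)) := by
    simp [summable_zero]
  exact ⟨hasDerivAt_tsum_of_isPreconnected
      (g := fun (m : ℕ) (w : ℂ) => w / ((m : ℂ) + 1) - log (1 + w / ((m : ℂ) + 1)))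
      (g' := fun (m : ℕ) (w : ℂ) => 1 / ((m : ℂ) + 1) - 1 / ((m : ℂ) + 1 + w))
      hs hto htc hder hbd h0 hz0 hzt,
    summable_of_summable_hasDerivAt_of_isPreconnected
      (g := fun (m : ℕ) (w : ℂ) => w / ((m : ℂ) + 1) - log (1 + w / ((m : ℂ) + 1)))
      (g' := fun (m : ℕ) (w : ℂ) => 1 / ((m : ℂ) + 1) - 1 / ((m : ℂ) + 1 + w))
      hs hto htc hder hbd h0 hz0 hzt⟩

/-- Euler's limit n^z n!/(z(z+1)⋯(z+n)) is the exponential of a partial sum of the series, corrected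
by (H_n - log n)z, which tends to γz. -/
theorem Gamma_eq_exp_tsum_div {z : ℂ} (hz : 0 < z.re) :
    Gamma z = exp ((∑' m : ℕ, (z / ((m : ℂ) + 1) - log (1 + z / ((m : ℂ) + 1)))) -
      Real.eulerMascheroniConstant * z) / z := by
  have hz0 : z ≠ 0 := by rintro rfl; simp at hz
  have hsum := (hasDerivAt_tsum_sub_log (z := z) (by linarith)).2
  have h3 : ∀ m : ℕ, (m : ℂ) + 1 ≠ 0 := fun m => by exact_mod_cast Nat.succ_ne_zero m
  have hne : ∀ m : ℕ, 1 + z / ((m : ℂ) + 1) ≠ 0 := by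
    intro m h
    have h6 : z = -((m : ℂ) + 1) := by
      have := h3 m
      field_simp at h
      linear_combination h
    rw [h6] at hz
    simp at hz
    have : (0 : ℝ) ≤ m := Nat.cast_nonneg m
    linarith
  have hH : Tendsto (fun n : ℕ => (((harmonic n : ℝ) - Real.log n : ℝ) : ℂ)) atTop
      (𝓝 (Real.eulerMascheroniConstant : ℂ)) :=
    (continuous_ofReal.tendsto _).comp Real.tendsto_harmonic_sub_log
  have hlim := (((hsum.hasSum.tendsto_sum_nat.sub (hH.mul_const z)).cexp).div_const z)
  refine tendsto_nhds_unique (GammaSeq_tendsto_Gamma z) (hlim.congr' ?_)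
  filter_upwards [eventually_ne_atTop 0] with n hn
  have hn' : (n : ℂ) ≠ 0 := Nat.cast_ne_zero.2 hn
  rw [GammaSeq, Finset.prod_range_succ', Finset.sum_sub_distrib, cpow_def_of_ne_zero hn']
  have hprod : exp (∑ m ∈ Finset.range n, log (1 + z / ((m : ℂ) + 1))) * (n.factorial : ℂ) =
      ∏ m ∈ Finset.range n, (z + ((m + 1 : ℕ) : ℂ)) := by
    rw [exp_sum, ← Finset.prod_range_add_one_eq_factorial, Nat.cast_prod, ← Finset.prod_mul_distrib]
    refine Finset.prod_congr rfl fun m _ => ?_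
    rw [exp_log (hne m)]
    have := h3 m
    push_cast
    field_simp
    ring
  have hharm : ∑ m ∈ Finset.range n, z / ((m : ℂ) + 1) = z * (harmonic n : ℂ) := by
    rw [harmonic, Rat.cast_sum, Finset.mul_sum]
    refine Finset.sum_congr rfl fun m _ => ?_
    push_cast
    rw [div_eq_mul_inv]
  have hexp := exp_ne_zero (∑ m ∈ Finset.range n, log (1 + z / ((m : ℂ) + 1)))
  have hfac : (n.factorial : ℂ) ≠ 0 := Nat.cast_ne_zero.2 n.factorial_ne_zero
  rw [← hprod, hharm, Complex.ofReal_sub, ofReal_log (Nat.cast_nonneg n)]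
  push_cast
  rw [show z * (harmonic n : ℂ) - ∑ m ∈ Finset.range n, log (1 + z / ((m : ℂ) + 1)) -
      ((harmonic n : ℂ) - log (n : ℂ)) * z = log (n : ℂ) * z -
        ∑ m ∈ Finset.range n, log (1 + z / ((m : ℂ) + 1)) by ring, exp_sub]
  simp only [add_zero]
  field_simp

theorem digamma_eq_tsum_of_re_pos {z : ℂ} (hz : 0 < z.re) :
    digamma z = -Real.eulerMascheroniConstant - 1 / z +
      ∑' m : ℕ, (1 / ((m : ℂ) + 1) - 1 / ((m : ℂ) + 1 + z)) := by
  have hz0 : z ≠ 0 := by rintro rfl; simp at hz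
  have hd := ((((hasDerivAt_tsum_sub_log (z := z) (by linarith)).1.sub
    ((hasDerivAt_id z).const_mul (Real.eulerMascheroniConstant : ℂ))).cexp).div
      (hasDerivAt_id z) hz0)
  have hd' := hd.congr_of_eventuallyEq (f₁ := Gamma) (by
    filter_upwards [(isOpen_lt continuous_const continuous_re).mem_nhds hz] with w hw
    exact Gamma_eq_exp_tsum_div hw)
  rw [digamma_def, logDeriv_apply, hd'.deriv, Gamma_eq_exp_tsum_div hz]
  have := exp_ne_zero ((∑' m : ℕ, (z / ((m : ℂ) + 1) - log (1 + z / ((m : ℂ) + 1)))) -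
      Real.eulerMascheroniConstant * z)
  simp only [Pi.sub_apply, id]
  field_simp
  ring

/-- The partial fraction expansion of the digamma function. -/
theorem digamma_eq_tsum {z : ℂ} (hz : ∀ m : ℕ, z ≠ -m) :
    digamma z = -Real.eulerMascheroniConstant - 1 / z +
      ∑' m : ℕ, (1 / ((m : ℂ) + 1) - 1 / ((m : ℂ) + 1 + z)) := by
  -- The recurrence ψ(z+1) = ψ(z) + 1/z carries the formula one unit to the left at a time, the
  -- difference of the two series telescoping. The left half-plane matters because ±iz may lie there
  -- when Re z > 0.
  suffices H : ∀ (n : ℕ) (z : ℂ), (∀ m : ℕ, z ≠ -m) → -(n : ℝ) < z.re →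
      digamma z = -Real.eulerMascheroniConstant - 1 / z +
        ∑' m : ℕ, (1 / ((m : ℂ) + 1) - 1 / ((m : ℂ) + 1 + z)) by
    obtain ⟨n, hn⟩ := exists_nat_gt (-z.re)
    exact H n z hz (by linarith)
  intro n
  induction n with
  | zero => exact fun z _ h => digamma_eq_tsum_of_re_pos (by simpa using h)
  | succ n ih =>
    intro z hz hn
    have hz1 : ∀ m : ℕ, z + 1 ≠ -m := by
      intro m h
      exact hz (m + 1) (by push_cast; linear_combination h)
    have h1 := ih (z + 1) hz1 (by push_cast at hn; simp; linarith)
    have h2 := digamma_apply_add_one z hz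
    have hs := (summable_inv_sub_inv_add (z + 1)).sub (summable_inv_sub_inv_add z)
    have htel : HasSum (fun m : ℕ => (1 / ((m : ℂ) + 1) - 1 / ((m : ℂ) + 1 + (z + 1))) -
        (1 / ((m : ℂ) + 1) - 1 / ((m : ℂ) + 1 + z))) (1 / (z + 1)) := by
      rw [hs.hasSum_iff_tendsto_nat]
      have : ∀ M : ℕ, ∑ m ∈ Finset.range M, ((1 / ((m : ℂ) + 1) - 1 / ((m : ℂ) + 1 + (z + 1))) -
          (1 / ((m : ℂ) + 1) - 1 / ((m : ℂ) + 1 + z))) = 1 / (z + 1) - 1 / ((M : ℂ) + (z + 1)) := by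
        intro M
        induction M with
        | zero => simp
        | succ M ihM =>
          rw [Finset.sum_range_succ, ihM]
          push_cast
          rw [show (M : ℂ) + 1 + z = M + (z + 1) by ring]
          ring
      simp_rw [this]
      have hl : Tendsto (fun M : ℕ => 1 / ((M : ℂ) + (z + 1))) atTop (𝓝 0) := by
        simp_rw [one_div]
        exact tendsto_inv₀_cobounded.comp
          ((tendsto_add_const_cobounded (z + 1)).comp tendsto_natCast_atTop_cobounded)
      simpa using tendsto_const_nhds.sub hl
    have h4 := htel.tsum_eq
    rw [(summable_inv_sub_inv_add (z + 1)).tsum_sub (summable_inv_sub_inv_add z)] at h4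
    rw [h1, ← one_div] at h2
    linear_combination h4 - h2

/-! ### Growth of ψ - log along rays and absolute convergence -/

/-- The segment from 1 to z misses 0 because z is not a nonpositive real. Compactness gives a
positive minimum of the norm, and homogeneity extends it to all s, t ≥ 0. -/
theorem exists_forall_mul_add_le_norm_add_mul {z : ℂ} (hz : z ∈ slitPlane) :
    ∃ c : ℝ, 0 < c ∧ ∀ s t : ℝ, 0 ≤ s → 0 ≤ t → c * (s + t) ≤ ‖(s : ℂ) + t * z‖ := by
  obtain ⟨u, hu, hmin⟩ := (isCompact_Icc (a := (0 : ℝ)) (b := 1)).exists_isMinOn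
    (Set.nonempty_Icc.2 zero_le_one)
    (f := fun u : ℝ => ‖((1 - u : ℝ) : ℂ) + (u : ℝ) * z‖) (by fun_prop)
  refine ⟨‖((1 - u : ℝ) : ℂ) + (u : ℝ) * z‖, norm_pos_iff.2 fun h => ?_, fun s t hs ht => ?_⟩
  · have hu1 : u ≠ 0 := by rintro rfl; simp at h
    have hu0 : 0 < u := lt_of_le_of_ne hu.1 hu1.symm
    have hz' : z = ((-((1 - u) / u) : ℝ) : ℂ) := by
      have : (u : ℂ) ≠ 0 := by exact_mod_cast hu1
      push_cast at h ⊢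
      field_simp
      linear_combination h
    rw [hz', ofReal_mem_slitPlane] at hz
    have : 0 ≤ (1 - u) / u := div_nonneg (by linarith [hu.2]) hu0.le
    linarith
  · rcases (add_nonneg hs ht).eq_or_lt with h | h
    · rw [← h, mul_zero]; positivity
    · have hmem : t / (s + t) ∈ Set.Icc (0 : ℝ) 1 :=
        ⟨by positivity, (div_le_one h).2 (by linarith)⟩
      have h1 := hmin hmem
      simp only [Set.mem_ofPred_eq] at h1
      have h2 : (s : ℂ) + t * z =
          ((s + t : ℝ) : ℂ) * (((1 - t / (s + t) : ℝ) : ℂ) + ((t / (s + t) : ℝ) : ℂ) * z) := by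
        have : ((s : ℂ) + t) ≠ 0 := by exact_mod_cast h.ne'
        push_cast
        field_simp
        ring
      rw [h2, norm_mul, norm_real, Real.norm_of_nonneg h.le, mul_comm]
      gcongr

theorem ne_neg_natCast_of_mem_slitPlane {z : ℂ} (hz : z ∈ slitPlane) (m : ℕ) : z ≠ -m := by
  rintro rfl
  rw [← ofReal_natCast, ← ofReal_neg, ofReal_mem_slitPlane] at hz
  have : (0 : ℝ) ≤ m := Nat.cast_nonneg m
  linarith

theorem ofReal_mul_mem_slitPlane {t : ℝ} {z : ℂ} (ht : 0 < t) (hz : z ∈ slitPlane) :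
    (t : ℂ) * z ∈ slitPlane := by
  rw [mem_slitPlane_iff] at hz ⊢
  rw [re_ofReal_mul, im_ofReal_mul]
  exact hz.imp (fun h => mul_pos ht h) (fun h => mul_ne_zero ht.ne' h)

/-- Far from the true decay, but enough here: all series in the theorem have exponent a > 1, so an
arbitrarily small power of growth is harmless. The bound comes from |m+1+tz| ≥ c(m+1+t) ≥ c(m+1)^ε
t^{1-ε} in the partial fractions. -/
theorem norm_digamma_sub_log_le_rpow {z : ℂ} (hz : z ∈ slitPlane) {ε : ℝ} (hε : 0 < ε)
    (hε1 : ε < 1) :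
    ∃ C : ℝ, ∀ t : ℝ, 1 ≤ t → ‖digamma (t * z) - log (t * z)‖ ≤ C * t ^ ε := by
  obtain ⟨c, hc, hcz⟩ := exists_forall_mul_add_le_norm_add_mul hz
  have hz0 : z ≠ 0 := slitPlane_ne_zero hz
  have hS : Summable fun m : ℕ => 1 / ((m : ℝ) + 1) ^ (1 + ε) := by
    exact_mod_cast (summable_nat_add_iff 1).2
      (Real.summable_one_div_nat_rpow.2 (by linarith : 1 < 1 + ε))
  refine ⟨|Real.eulerMascheroniConstant| + 1 / ‖z‖ + (‖z‖ / c) *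
    ∑' m : ℕ, 1 / ((m : ℝ) + 1) ^ (1 + ε) + (1 / ε + ‖log z‖), fun t ht => ?_⟩
  have ht0 : 0 < t := by linarith
  have hte : 1 ≤ t ^ ε := Real.one_le_rpow ht hε.le
  have hterm : ∀ m : ℕ, ‖1 / ((m : ℂ) + 1) - 1 / ((m : ℂ) + 1 + t * z)‖ ≤
      (‖z‖ / c * t ^ ε) * (1 / ((m : ℝ) + 1) ^ (1 + ε)) := by
    intro m
    have hm : (0 : ℝ) < (m : ℝ) + 1 := by positivity
    have h3 : (m : ℂ) + 1 ≠ 0 := by exact_mod_cast Nat.succ_ne_zero m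
    have h1 : ‖((m : ℂ) + 1)‖ = (m : ℝ) + 1 := by
      rw [show ((m : ℂ) + 1) = ((m + 1 : ℕ) : ℂ) by push_cast; ring, norm_natCast]; push_cast; ring
    have h2 := hcz (m + 1) t hm.le ht0.le
    push_cast at h2
    have h4 : (m : ℂ) + 1 + t * z ≠ 0 := by
      rw [← norm_pos_iff]; exact lt_of_lt_of_le (by positivity) h2
    have h6 : ((m : ℝ) + 1) ^ ε * t ^ (1 - ε) ≤ (m : ℝ) + 1 + t := by
      calc ((m : ℝ) + 1) ^ ε * t ^ (1 - ε)
          ≤ ((m : ℝ) + 1 + t) ^ ε * ((m : ℝ) + 1 + t) ^ (1 - ε) := by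
            gcongr
            · linarith
            · linarith
        _ = (m : ℝ) + 1 + t := by
            rw [← Real.rpow_add (by positivity)]; simp
    have h5 : 1 / ((m : ℂ) + 1) - 1 / ((m : ℂ) + 1 + t * z) =
        t * z / (((m : ℂ) + 1) * ((m : ℂ) + 1 + t * z)) := by
      field_simp; ring
    rw [h5, norm_div, norm_mul, norm_mul, h1, norm_real, Real.norm_of_nonneg ht0.le]
    calc t * ‖z‖ / (((m : ℝ) + 1) * ‖(m : ℂ) + 1 + t * z‖)
        ≤ t * ‖z‖ / (((m : ℝ) + 1) * (c * (((m : ℝ) + 1) ^ ε * t ^ (1 - ε)))) := by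
          gcongr
          exact le_trans (by gcongr) h2
      _ = (‖z‖ / c * t ^ ε) * (1 / ((m : ℝ) + 1) ^ (1 + ε)) := by
          rw [Real.rpow_add hm, Real.rpow_sub ht0, Real.rpow_one, Real.rpow_one]
          field_simp
  have htsum : ‖∑' m : ℕ, (1 / ((m : ℂ) + 1) - 1 / ((m : ℂ) + 1 + t * z))‖ ≤
      (‖z‖ / c * t ^ ε) * ∑' m : ℕ, 1 / ((m : ℝ) + 1) ^ (1 + ε) := by
    rw [← tsum_mul_left]
    exact tsum_of_norm_bounded (hS.mul_left _).hasSum hterm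
  have hlog : ‖log (t * z)‖ ≤ (1 / ε + ‖log z‖) * t ^ ε := by
    rw [log_ofReal_mul ht0 hz0]
    have h1 : Real.log t ≤ t ^ ε / ε := Real.log_le_rpow_div ht0.le hε
    have h2 : 0 ≤ Real.log t := Real.log_nonneg ht
    calc ‖(Real.log t : ℂ) + log z‖ ≤ ‖(Real.log t : ℂ)‖ + ‖log z‖ := norm_add_le _ _
      _ = Real.log t + ‖log z‖ := by rw [norm_real, Real.norm_of_nonneg h2]
      _ ≤ t ^ ε / ε + ‖log z‖ * t ^ ε := by
          gcongr
          exact le_mul_of_one_le_right (norm_nonneg _) hte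
      _ = _ := by ring
  have hinv : ‖1 / ((t : ℂ) * z)‖ ≤ 1 / ‖z‖ * t ^ ε := by
    rw [norm_div, norm_one, norm_mul, norm_real, Real.norm_of_nonneg ht0.le]
    have : 0 < ‖z‖ := norm_pos_iff.2 hz0
    calc 1 / (t * ‖z‖) ≤ 1 / (1 * ‖z‖) := by gcongr
      _ = 1 / ‖z‖ * 1 := by ring
      _ ≤ _ := by gcongr
  have hg : ‖-(Real.eulerMascheroniConstant : ℂ)‖ ≤ |Real.eulerMascheroniConstant| * t ^ ε := by
    rw [norm_neg, norm_real, Real.norm_eq_abs]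
    exact le_mul_of_one_le_right (abs_nonneg _) hte
  rw [digamma_eq_tsum (ne_neg_natCast_of_mem_slitPlane (ofReal_mul_mem_slitPlane ht0 hz))]
  refine (norm_sub_le _ _).trans ?_
  have h1 := norm_add_le (-(Real.eulerMascheroniConstant : ℂ) - 1 / (t * z))
    (∑' m : ℕ, (1 / ((m : ℂ) + 1) - 1 / ((m : ℂ) + 1 + t * z)))
  have h2 := norm_sub_le (-(Real.eulerMascheroniConstant : ℂ)) (1 / (t * z))
  linarith

theorem summable_extHerglotzTerm {a b : ℝ} (ha : 1 < a) (hb : 0 < b) {z : ℂ}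
    (hz : z ∈ slitPlane) : Summable (extHerglotzTerm a b z) := by
  obtain ⟨ε, hε, hε1, hε2⟩ : ∃ ε : ℝ, 0 < ε ∧ ε < 1 ∧ b * ε < a - 1 := by
    have h : 0 < (a - 1) / b := div_pos (by linarith) hb
    obtain ⟨ε, h1, h2⟩ := exists_between (lt_min zero_lt_one h)
    refine ⟨ε, h1, h2.trans_le (min_le_left _ _), ?_⟩
    have := h2.trans_le (min_le_right _ _)
    rw [lt_div_iff₀ hb] at this
    linarith
  obtain ⟨C, hC⟩ := norm_digamma_sub_log_le_rpow hz hε hε1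
  have hS : Summable fun n : ℕ => C * (1 / ((n : ℝ) + 1) ^ (a - b * ε)) := by
    refine Summable.mul_left _ ?_
    exact_mod_cast (summable_nat_add_iff 1).2
      (Real.summable_one_div_nat_rpow.2 (by linarith : 1 < a - b * ε))
  refine Summable.of_norm_bounded hS fun n => ?_
  have hn : (0 : ℝ) < (n : ℝ) + 1 := by positivity
  have h := hC (((n : ℝ) + 1) ^ b) (Real.one_le_rpow (by simp) hb.le)
  rw [extHerglotzTerm, norm_div, norm_real, Real.norm_of_nonneg (by positivity)]
  calc _ ≤ C * (((n : ℝ) + 1) ^ b) ^ ε / ((n : ℝ) + 1) ^ a := by gcongr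
    _ = _ := by
      rw [← Real.rpow_mul hn.le, Real.rpow_sub hn]
      field_simp

/-! ### The even combination at ±iz -/

/-- The even combination of the terms of the Herglotz functions at `I * z` and `-I * z`. -/
noncomputable def digammaPair (z : ℂ) : ℂ :=
  digamma (I * z) - log (I * z) + (digamma (-I * z) - log (-I * z))

theorem I_mul_mem_slitPlane {z : ℂ} (hz : 0 < z.re) : I * z ∈ slitPlane := by
  right; simpa using hz.ne'

theorem neg_I_mul_mem_slitPlane {z : ℂ} (hz : 0 < z.re) : -I * z ∈ slitPlane := by
  right; simpa using hz.ne'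

/-- Since |arg z| < π/2, multiplying by ±i does not cross the branch cut, and the terms ±iπ/2
cancel. -/
theorem log_I_mul_add_log_neg_I_mul {z : ℂ} (hz : 0 < z.re) :
    log (I * z) + log (-I * z) = 2 * log z := by
  have hz0 : z ≠ 0 := by rintro rfl; simp at hz
  have harg := abs_lt.1 (abs_arg_lt_pi_div_two_iff.2 (Or.inl hz))
  rw [log_mul_eq_add_log_iff I_ne_zero hz0 |>.2, log_mul_eq_add_log_iff (neg_ne_zero.2 I_ne_zero) hz0 |>.2,
    log_I, log_neg_I]
  · ring
  · rw [arg_neg_I]; constructor <;> linarith [Real.pi_pos]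
  · rw [arg_I]; constructor <;> linarith [Real.pi_pos]

/-- Adding the expansions at iz and -iz cancels the poles 1/(±iz) and pairs the remaining fractions
over the denominator (n+1)² + z². -/
theorem hasSum_digammaPair {z : ℂ} (hz : 0 < z.re) :
    HasSum (fun n : ℕ => 2 / ((n : ℂ) + 1) * (z ^ 2 / (((n : ℂ) + 1) ^ 2 + z ^ 2)))
      (digammaPair z + 2 * Real.eulerMascheroniConstant + 2 * log z) := by
  have hz0 : z ≠ 0 := by rintro rfl; simp at hz
  have h1 := I_mul_mem_slitPlane hz
  have h2 := neg_I_mul_mem_slitPlane hz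
  have h := (summable_inv_sub_inv_add (I * z)).hasSum.add (summable_inv_sub_inv_add (-I * z)).hasSum
  convert h using 1
  · funext n
    have h3 : (n : ℂ) + 1 ≠ 0 := by exact_mod_cast Nat.succ_ne_zero n
    have h4 : (n : ℂ) + 1 + I * z ≠ 0 := fun h =>
      ne_neg_natCast_of_mem_slitPlane h1 (n + 1) (by push_cast; linear_combination h)
    have h5 : (n : ℂ) + 1 + -I * z ≠ 0 := fun h =>
      ne_neg_natCast_of_mem_slitPlane h2 (n + 1) (by push_cast; linear_combination h)
    have h6 : z ^ 2 = -(I * z) ^ 2 := by linear_combination z ^ 2 * I_sq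
    have h7 : -(I * z) ^ 2 / (((n : ℂ) + 1) ^ 2 + -(I * z) ^ 2) =
        -(I * z) ^ 2 / (((n : ℂ) + 1 + I * z) * ((n : ℂ) + 1 + -I * z)) := by ring
    rw [h6, h7]
    rw [neg_mul] at h5 ⊢
    generalize I * z = w at h4 h5 ⊢
    field_simp
    ring
  · rw [digammaPair, digamma_eq_tsum (ne_neg_natCast_of_mem_slitPlane h1),
      digamma_eq_tsum (ne_neg_natCast_of_mem_slitPlane h2)]
    have h7 : 1 / (I * z) + 1 / (-I * z) = 0 := by
      field_simp; ring
    linear_combination (-1 : ℂ) * log_I_mul_add_log_neg_I_mul hz - h7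

theorem extHerglotz_add_extHerglotz {a b : ℝ} (ha : 1 < a) (hb : 0 < b) {z : ℂ} (hz : 0 < z.re) :
    HasSum (fun n : ℕ => digammaPair ((((n : ℝ) + 1) ^ b : ℝ) * z) / (((n : ℝ) + 1) ^ a : ℝ))
      (extHerglotz a b (I * z) + extHerglotz a b (-I * z)) := by
  have h := (summable_extHerglotzTerm ha hb (I_mul_mem_slitPlane hz)).hasSum.add
    (summable_extHerglotzTerm ha hb (neg_I_mul_mem_slitPlane hz)).hasSum
  convert h using 1
  · funext n
    simp only [extHerglotzTerm, digammaPair, mul_left_comm _ I, mul_left_comm _ (-I), add_div]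
  · rfl

/-! ### Finite trigonometric sums and roots of unity -/

/-- The exponential `exp (i j θ)` with `j = 2 m - (N - 1)`. -/
noncomputable def stepExp (N : ℕ) (θ : ℂ) (m : ℕ) : ℂ :=
  exp (I * (2 * (m : ℂ) - ((N : ℂ) - 1)) * θ)

/-- Dirichlet kernel: multiplication by e^{iθ} - e^{-iθ} makes the sum telescope. -/
theorem sum_stepExp_mul_sin (N : ℕ) (θ : ℂ) :
    (∑ m ∈ Finset.range N, stepExp N θ m) * sin θ = sin (N * θ) := by
  have h : ∀ M : ℕ, (∑ m ∈ Finset.range M, stepExp N θ m) * (exp (I * θ) - exp (-(I * θ))) =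
      exp (I * (2 * M - N) * θ) - exp (-(I * N * θ)) := by
    intro M
    induction M with
    | zero => simp
    | succ M ih =>
      rw [Finset.sum_range_succ, add_mul, ih, stepExp, mul_sub (exp _), ← exp_add, ← exp_add]
      push_cast
      ring_nf
  have h1 := h N
  rw [sin, sin, show -θ * I = -(I * θ) by ring, show θ * I = I * θ by ring,
    show -(N * θ) * I = -(I * N * θ) by ring, show (N * θ) * I = I * (2 * N - N) * θ by ring]
  linear_combination (-I / 2) * h1

/-- Derivative in θ of the Dirichlet kernel identity; it evaluates sums weighted by j. -/
theorem sum_stepExp_deriv (N : ℕ) (θ : ℂ) :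
    (∑ m ∈ Finset.range N, I * (2 * (m : ℂ) - ((N : ℂ) - 1)) * stepExp N θ m) * sin θ +
      (∑ m ∈ Finset.range N, stepExp N θ m) * cos θ = N * cos (N * θ) := by
  have h1 : HasDerivAt (fun θ : ℂ => ∑ m ∈ Finset.range N, stepExp N θ m)
      (∑ m ∈ Finset.range N, I * (2 * (m : ℂ) - ((N : ℂ) - 1)) * stepExp N θ m) θ := by
    refine HasDerivAt.fun_sum fun m _ => ?_
    refine (((hasDerivAt_id θ).const_mul (I * (2 * (m : ℂ) - ((N : ℂ) - 1)))).cexp).congr_deriv ?_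
    simp only [stepExp, id]
    ring
  have h2 := h1.mul (hasDerivAt_sin θ)
  have h3 := ((hasDerivAt_id θ).const_mul (N : ℂ)).csin
  have h4 : (fun θ : ℂ => (∑ m ∈ Finset.range N, stepExp N θ m) * sin θ) =
      fun θ : ℂ => sin (N * θ) := funext (sum_stepExp_mul_sin N)
  have h5 := (h2.congr_of_eventuallyEq (f₁ := fun θ : ℂ => sin (N * θ))
    (Eventually.of_forall fun w => (congrFun h4 w).symm)).unique h3
  rw [h5]
  simp only [id]
  ring

/-- The value of `stepExp` at `θ = π / N`, an `N`-th root of unity when `N` is odd. -/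
theorem stepExp_pi_div_pow {N : ℕ} (hN : Odd N) (m : ℕ) :
    stepExp N ((Real.pi : ℂ) / N) m ^ N = 1 := by
  obtain ⟨l, rfl⟩ := hN
  have h : ((2 * l + 1 : ℕ) : ℂ) ≠ 0 := Nat.cast_ne_zero.2 (by omega)
  rw [stepExp, ← exp_nat_mul, exp_eq_one_iff]
  refine ⟨(m : ℤ) - l, ?_⟩
  field_simp
  push_cast
  ring

theorem sin_pi_mul_div_ne_zero {N : ℕ} (hN : N ≠ 0) {l : ℤ} (hl : ¬ (N : ℤ) ∣ l) :
    sin ((Real.pi : ℂ) * l / N) ≠ 0 := by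
  rw [Ne, sin_eq_zero_iff]
  rintro ⟨q, hq⟩
  refine hl ⟨q, ?_⟩
  have : (N : ℂ) ≠ 0 := Nat.cast_ne_zero.2 hN
  have : (Real.pi : ℂ) ≠ 0 := by exact_mod_cast Real.pi_ne_zero
  field_simp at hq
  exact_mod_cast hq

/-- Orthogonality of characters. For N ∤ l the Dirichlet kernel at θ = πl/N vanishes, since sin(πl)
= 0 while sin(πl/N) ≠ 0. -/
theorem sum_stepExp_zpow {N : ℕ} (hN : Odd N) (l : ℤ) :
    ∑ m ∈ Finset.range N, stepExp N ((Real.pi : ℂ) / N) m ^ l = if (N : ℤ) ∣ l then (N : ℂ) else 0 := by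
  have hN0 : N ≠ 0 := by rintro rfl; simp at hN
  split_ifs with h
  · obtain ⟨q, rfl⟩ := h
    simp [zpow_mul, zpow_natCast, stepExp_pi_div_pow hN]
  · have h1 := sum_stepExp_mul_sin N ((Real.pi : ℂ) * l / N)
    have h2 : (N : ℂ) * ((Real.pi : ℂ) * l / N) = l * Real.pi := by
      have : (N : ℂ) ≠ 0 := Nat.cast_ne_zero.2 hN0
      field_simp
    rw [h2, sin_int_mul_pi] at h1
    rw [← (mul_eq_zero.1 h1).resolve_right (sin_pi_mul_div_ne_zero hN0 h)]
    refine Finset.sum_congr rfl fun m _ => ?_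
    rw [stepExp, stepExp, ← exp_int_mul]
    congr 1
    ring

/-- Partial fractions over the `N`-th roots of unity. -/
theorem sum_stepExp_partial_fraction {N r q : ℕ} (hN : Odd N) (hr : 1 ≤ r) (hrN : r ≤ N) (a v : ℂ)
    (h : a ^ N + v ^ N ≠ 0) :
    ∑ m ∈ Finset.range N, (stepExp N ((Real.pi : ℂ) / N) m ^ (N * q + r))⁻¹ *
        (v * stepExp N ((Real.pi : ℂ) / N) m / (a + v * stepExp N ((Real.pi : ℂ) / N) m)) =
      -(N * (-v) ^ r * a ^ (N - r) / (a ^ N + v ^ N)) := by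
  have hterm : ∀ m : ℕ, (stepExp N ((Real.pi : ℂ) / N) m ^ (N * q + r))⁻¹ *
        (v * stepExp N ((Real.pi : ℂ) / N) m / (a + v * stepExp N ((Real.pi : ℂ) / N) m)) =
      -(∑ i ∈ Finset.range N, a ^ (N - 1 - i) * (-v) ^ (i + 1) *
        stepExp N ((Real.pi : ℂ) / N) m ^ ((i : ℤ) + 1 - (N * q + r : ℕ))) / (a ^ N + v ^ N) := by
    intro m
    have hw := stepExp_pi_div_pow hN m
    have hw0 : stepExp N ((Real.pi : ℂ) / N) m ≠ 0 := exp_ne_zero _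
    generalize stepExp N ((Real.pi : ℂ) / N) m = w at hw hw0
    -- As N is odd and w^N = 1, a^N + v^N = a^N - (-vw)^N, so a + vw divides it with a geometric
    -- quotient.
    have hgeom : (∑ i ∈ Finset.range N, (-(v * w)) ^ i * a ^ (N - 1 - i)) * (a + v * w) =
        a ^ N + v ^ N := by
      have := geom_sum₂_mul (-(v * w)) a N
      rw [hN.neg_pow, mul_pow, hw] at this
      linear_combination -this
    have h1 : a + v * w ≠ 0 := by
      intro h0
      rw [h0, mul_zero] at hgeom
      exact h hgeom.symm
    have h2 : ∑ i ∈ Finset.range N, a ^ (N - 1 - i) * (-v) ^ (i + 1) *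
        w ^ ((i : ℤ) + 1 - (N * q + r : ℕ)) = -(v * w * (w ^ (N * q + r))⁻¹) *
          ∑ i ∈ Finset.range N, (-(v * w)) ^ i * a ^ (N - 1 - i) := by
      rw [Finset.mul_sum]
      refine Finset.sum_congr rfl fun i _ => ?_
      rw [zpow_sub₀ hw0, zpow_natCast, show ((i : ℤ) + 1) = ((i + 1 : ℕ) : ℤ) by push_cast; ring,
        zpow_natCast, neg_mul_eq_neg_mul v w, mul_pow]
      ring
    rw [h2, ← hgeom]
    have h3 : (∑ i ∈ Finset.range N, (-(v * w)) ^ i * a ^ (N - 1 - i)) ≠ 0 := by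
      intro h0
      rw [h0, zero_mul] at hgeom
      exact h hgeom.symm
    field_simp
  simp_rw [hterm]
  rw [← Finset.sum_div, Finset.sum_neg_distrib, Finset.sum_comm, neg_div]
  congr 2
  simp_rw [← Finset.mul_sum, sum_stepExp_zpow hN]
  -- Orthogonality keeps only i + 1 ≡ r mod N; since 1 ≤ r ≤ N and 0 ≤ i < N this forces i = r - 1.
  rw [Finset.sum_eq_single (r - 1)]
  · obtain ⟨r, rfl⟩ : ∃ s, r = s + 1 := ⟨r - 1, by omega⟩
    have : (N : ℤ) ∣ ((r + 1 - 1 : ℕ) : ℤ) + 1 - (N * q + (r + 1) : ℕ) := ⟨-q, by push_cast; simp⟩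
    rw [if_pos this, show N - 1 - (r + 1 - 1) = N - (r + 1) by omega, Nat.add_sub_cancel]
    ring
  · intro i hi hir
    rw [Finset.mem_range] at hi
    rw [if_neg, mul_zero]
    rintro ⟨c, hc⟩
    have h1 : (i : ℤ) + 1 - r = N * (c + q) := by push_cast at hc; linear_combination hc
    have h2 : |(i : ℤ) + 1 - r| < N := by rw [abs_lt]; constructor <;> omega
    have h3 := Int.eq_zero_of_abs_lt_dvd ⟨_, h1⟩ h2
    omega
  · intro h0
    exact absurd (Finset.mem_range.2 (by omega)) h0

/-- The differentiated identity at θ = -πp/N, where the unweighted sum vanishes. This is the source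
of the sine in 𝓒. -/
theorem sum_mul_stepExp {N p : ℕ} (hN : Odd N) (hp : ¬ N ∣ p) :
    ∑ m ∈ Finset.range N, I * (2 * (m : ℂ) - ((N : ℂ) - 1)) *
        (stepExp N ((Real.pi : ℂ) / N) m ^ p)⁻¹ =
      -(N * (-1) ^ p / sin ((Real.pi : ℂ) * p / N)) := by
  have hN0 : N ≠ 0 := by rintro rfl; simp at hN
  have hNC : (N : ℂ) ≠ 0 := Nat.cast_ne_zero.2 hN0
  have hs := sin_pi_mul_div_ne_zero hN0 (l := p) (by exact_mod_cast hp)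
  rw [Int.cast_natCast] at hs
  have h0 : ∀ m : ℕ, (stepExp N ((Real.pi : ℂ) / N) m ^ p)⁻¹ =
      stepExp N (-((Real.pi : ℂ) * p / N)) m := by
    intro m
    rw [stepExp, stepExp, ← exp_nat_mul, ← exp_neg]
    congr 1
    ring
  have h1 := sum_stepExp_deriv N (-((Real.pi : ℂ) * p / N))
  have h2 := sum_stepExp_mul_sin N (-((Real.pi : ℂ) * p / N))
  have h3 : (N : ℂ) * -((Real.pi : ℂ) * p / N) = -(p * Real.pi) := by field_simp
  have h4 : cos ((p : ℂ) * Real.pi) = (-1) ^ p := by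
    have := Real.cos_nat_mul_pi p
    exact_mod_cast congrArg ((↑) : ℝ → ℂ) this
  rw [h3, sin_neg, sin_neg, sin_nat_mul_pi, neg_zero] at h2
  rw [(mul_eq_zero.1 h2).resolve_right (neg_ne_zero.2 hs), zero_mul, add_zero, h3, cos_neg, sin_neg,
    h4] at h1
  simp_rw [h0]
  field_simp
  linear_combination -h1

/-! ### Series for ζ and ζ' at real points -/

theorem hasSum_zeta_real {a : ℝ} (ha : 1 < a) :
    HasSum (fun n : ℕ => (1 : ℂ) / (((n : ℝ) + 1) ^ a : ℝ)) (riemannZeta a) := by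
  have hs : Summable (fun n : ℕ => (1 : ℂ) / (((n : ℝ) + 1) ^ a : ℝ)) := by
    have : Summable fun n : ℕ => 1 / ((n : ℝ) + 1) ^ a := by
      exact_mod_cast (summable_nat_add_iff 1).2 (Real.summable_one_div_nat_rpow.2 ha)
    refine (ofRealCLM.summable this).congr fun n => ?_
    simp
  rw [zeta_eq_tsum_one_div_nat_add_one_cpow (by simpa using ha)]
  convert hs.hasSum using 1
  refine tsum_congr fun n => ?_
  rw [ofReal_cpow (by positivity)]
  push_cast
  rfl

theorem hasSum_log_zeta_deriv_real {a : ℝ} (ha : 1 < a) :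
    HasSum (fun n : ℕ => (Real.log ((n : ℝ) + 1) : ℂ) / (((n : ℝ) + 1) ^ a : ℝ))
      (-deriv riemannZeta a) := by
  have hab : LSeries.abscissaOfAbsConv 1 < ((a : ℂ).re : EReal) := by
    rw [LSeries.abscissaOfAbsConv_one, ofReal_re]; exact_mod_cast ha
  have h1 := LSeries_hasDerivAt hab
  have h2 : HasDerivAt riemannZeta (-LSeries (LSeries.logMul 1) a) a := by
    refine h1.congr_of_eventuallyEq ?_
    filter_upwards [(isOpen_lt continuous_const continuous_re).mem_nhds
      (show 1 < (a : ℂ).re by simpa using ha)] with w hw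
    exact (LSeries_one_eq_riemannZeta hw).symm
  rw [h2.deriv, neg_neg]
  have h3 := LSeriesSummable_logMul_of_lt_re hab
  have h4 := h3.hasSum
  rw [← hasSum_nat_add_iff' 1] at h4
  simp only [Finset.range_one, Finset.sum_singleton, LSeries.term_zero, sub_zero] at h4
  have h5 : (fun n : ℕ => (Real.log ((n : ℝ) + 1) : ℂ) / (((n : ℝ) + 1) ^ a : ℝ)) =
      fun n : ℕ => LSeries.term (LSeries.logMul 1) a (n + 1) := by
    funext n
    rw [LSeries.term_of_ne_zero (Nat.succ_ne_zero n), LSeries.logMul, ofReal_cpow (by positivity),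
      ofReal_log (by positivity)]
    push_cast
    simp
  rw [h5]
  exact h4

theorem HasSum.of_eq {f g : ℕ → ℂ} {a b : ℂ} (h : HasSum f a) (hf : ∀ n, g n = f n) (ha : b = a) :
    HasSum g b := by
  rw [funext hf, ha]
  exact h

/-! ### The double series, summed over m first -/

/-- The ratio `(n + 1) ^ N * y / (m + 1)`. -/
noncomputable def herglotzRatio (N : ℕ) (y : ℂ) (n m : ℕ) : ℂ :=
  ((n : ℂ) + 1) ^ N * y / ((m : ℂ) + 1)

/-- The kernel of the absolutely convergent double series behind the functional equation. -/
noncomputable def herglotzKernel (N p q : ℕ) (y : ℂ) (n m : ℕ) : ℂ :=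
  (-herglotzRatio N y n m ^ 2) ^ (q + 1) / (1 + herglotzRatio N y n m ^ 2) /
    (((n : ℂ) + 1) ^ (2 * p + 1) * ((m : ℂ) + 1))

theorem sq_mem_slitPlane {y : ℂ} (hy : 0 < y.re) : y ^ 2 ∈ slitPlane := by
  rw [mem_slitPlane_iff, sq, mul_re, mul_im]
  by_cases h : y.im = 0
  · left; rw [h]; nlinarith
  · right
    have := mul_ne_zero hy.ne' h
    intro h0
    apply this
    linarith

theorem norm_natCast_add_one (n : ℕ) : ‖(n : ℂ) + 1‖ = (n : ℝ) + 1 := by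
  rw [← Nat.cast_succ, norm_natCast, Nat.cast_succ]

/-- With s = |t/y|, interpolate |1+t²| ≥ c(1+s²) ≥ c s^{2(1-δ)}. The choice δ = 1/(2N) costs exactly
one power of n+1, leaving (n+1)^{-2r}(m+1)^{-1-2q-2δ}. This is summable because r ≥ 1, and δ > 0
covers q = 0. -/
theorem summable_herglotzKernel {N p q r : ℕ} (hN : N ≠ 0) (hr : 1 ≤ r) (hp : p = N * q + r) {y : ℂ}
    (hy : 0 < y.re) :
    Summable fun nm : ℕ × ℕ => herglotzKernel N p q y nm.1 nm.2 := by
  obtain ⟨c, hc, hcy⟩ := exists_forall_mul_add_le_norm_add_mul (sq_mem_slitPlane hy)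
  have hN1 : (0 : ℝ) < N := by exact_mod_cast Nat.pos_of_ne_zero hN
  have hN2 : (1 : ℝ) ≤ N := by exact_mod_cast Nat.pos_of_ne_zero hN
  obtain ⟨δ, hδ⟩ : ∃ δ : ℝ, δ = 1 / (2 * N) := ⟨_, rfl⟩
  have hδ0 : 0 < δ := by rw [hδ]; positivity
  have hδ1 : δ < 1 := by
    rw [hδ, div_lt_one (by positivity)]; linarith
  have h1 : Summable fun n : ℕ => ‖y‖ ^ (2 * (q + 1)) / c * (1 / ((n : ℝ) + 1) ^ 2) := by
    refine Summable.mul_left _ ?_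
    exact_mod_cast (summable_nat_add_iff 1).2 (Real.summable_one_div_nat_pow.2 (by norm_num : 1 < 2))
  have h2 : Summable fun m : ℕ => 1 / ((m : ℝ) + 1) ^ (1 + 2 * δ) := by
    exact_mod_cast (summable_nat_add_iff 1).2
      (Real.summable_one_div_nat_rpow.2 (by linarith : 1 < 1 + 2 * δ))
  refine Summable.of_norm_bounded
    (h1.mul_of_nonneg h2 (fun n => by positivity) (fun m => by positivity)) ?_
  rintro ⟨n, m⟩
  have hn : (0 : ℝ) < (n : ℝ) + 1 := by positivity
  have hm : (0 : ℝ) < (m : ℝ) + 1 := by positivity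
  obtain ⟨s, hs⟩ : ∃ s : ℝ, s = ((n : ℝ) + 1) ^ N / ((m : ℝ) + 1) := ⟨_, rfl⟩
  have hs0 : 0 < s := by rw [hs]; positivity
  have hratio : herglotzRatio N y n m = s * y := by
    rw [herglotzRatio, hs]; push_cast; ring
  have hden : c * (s ^ 2) ^ (1 - δ) ≤ ‖1 + ((s : ℂ) * y) ^ 2‖ := by
    have h3 := hcy 1 (s ^ 2) zero_le_one (by positivity)
    have h4 : (s ^ 2) ^ (1 - δ) ≤ 1 + s ^ 2 := by
      calc (s ^ 2) ^ (1 - δ) ≤ (1 + s ^ 2) ^ (1 - δ) := by gcongr; linarith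
        _ ≤ (1 + s ^ 2) ^ (1 : ℝ) :=
          Real.rpow_le_rpow_of_exponent_le (by nlinarith) (by linarith)
        _ = 1 + s ^ 2 := Real.rpow_one _
    calc c * (s ^ 2) ^ (1 - δ) ≤ c * (1 + s ^ 2) := by gcongr
      _ ≤ _ := h3
      _ = _ := by push_cast; rw [mul_pow]
  rw [herglotzKernel, hratio, norm_div, norm_div, norm_mul, norm_pow, norm_neg, norm_pow, norm_pow,
    norm_natCast_add_one, norm_natCast_add_one, norm_mul, norm_real, Real.norm_of_nonneg hs0.le]
  have hpow : (s ^ 2) ^ (q + 1) / (s ^ 2) ^ (1 - δ) = (s ^ 2) ^ ((q : ℝ) + δ) := by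
    rw [← Real.rpow_natCast, ← Real.rpow_sub (by positivity)]
    congr 1
    push_cast
    ring
  have hpow2 : (s ^ 2) ^ ((q : ℝ) + δ) =
      ((n : ℝ) + 1) ^ (2 * N * q + 1) / (((m : ℝ) + 1) ^ (2 * q) * ((m : ℝ) + 1) ^ (2 * δ)) := by
    have h5 : ((((n : ℝ) + 1) ^ N) ^ 2) ^ ((q : ℝ) + δ) = ((n : ℝ) + 1) ^ (2 * N * q + 1) := by
      rw [← pow_mul, ← Real.rpow_natCast _ (N * 2), ← Real.rpow_mul hn.le, ← Real.rpow_natCast]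
      congr 1
      rw [hδ]
      push_cast
      field_simp
    have h6 : (((m : ℝ) + 1) ^ 2) ^ ((q : ℝ) + δ) =
        ((m : ℝ) + 1) ^ (2 * q) * ((m : ℝ) + 1) ^ (2 * δ) := by
      rw [← Real.rpow_natCast _ 2, ← Real.rpow_natCast _ (2 * q), ← Real.rpow_mul hm.le,
        ← Real.rpow_add hm]
      congr 1
      push_cast
      ring
    rw [hs, div_pow, Real.div_rpow (by positivity) (by positivity), h5, h6]
  have hq1 : (1 : ℝ) ≤ ((m : ℝ) + 1) ^ (2 * q) := one_le_pow₀ (by simp)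
  have hr1 : ((n : ℝ) + 1) ^ 2 ≤ ((n : ℝ) + 1) ^ (2 * r) :=
    pow_le_pow_right₀ (by simp) (by omega)
  calc ((s * ‖y‖) ^ 2) ^ (q + 1) / ‖1 + ((s : ℂ) * y) ^ 2‖ /
        (((n : ℝ) + 1) ^ (2 * p + 1) * ((m : ℝ) + 1))
      ≤ ((s * ‖y‖) ^ 2) ^ (q + 1) / (c * (s ^ 2) ^ (1 - δ)) /
        (((n : ℝ) + 1) ^ (2 * p + 1) * ((m : ℝ) + 1)) := by gcongr
    _ = ‖y‖ ^ (2 * (q + 1)) / c * ((s ^ 2) ^ (q + 1) / (s ^ 2) ^ (1 - δ)) /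
        (((n : ℝ) + 1) ^ (2 * p + 1) * ((m : ℝ) + 1)) := by
        rw [mul_pow, mul_pow, pow_mul ‖y‖]; field_simp
    _ = ‖y‖ ^ (2 * (q + 1)) / c * (1 / ((n : ℝ) + 1) ^ (2 * r)) *
        (1 / (((m : ℝ) + 1) ^ (2 * q) * (((m : ℝ) + 1) * ((m : ℝ) + 1) ^ (2 * δ)))) := by
        rw [hpow, hpow2, hp]
        field_simp
        ring
    _ ≤ ‖y‖ ^ (2 * (q + 1)) / c * (1 / ((n : ℝ) + 1) ^ 2) *
        (1 / (1 * (((m : ℝ) + 1) * ((m : ℝ) + 1) ^ (2 * δ)))) := by gcongr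
    _ = _ := by rw [Real.rpow_add hm, Real.rpow_one, one_mul]

theorem log_natCast_add_one_rpow_mul {n : ℕ} {b : ℝ} {z : ℂ} (hz : z ≠ 0) :
    log ((((n : ℝ) + 1) ^ b : ℝ) * z) = b * Real.log ((n : ℝ) + 1) + log z := by
  rw [log_ofReal_mul (by positivity) hz, Real.log_rpow (by positivity)]
  push_cast
  ring

/-- By the finite geometric series, (-t²)^{q+1}/(1+t²) = -t²/(1+t²) - ∑_{i=1}^q (-t²)^i. The first
term sums over m to the digamma pair, the others to values ζ(2i+1). -/
theorem hasSum_herglotzKernel_right {N : ℕ} (p q : ℕ) {y : ℂ} (hy : 0 < y.re) (n : ℕ) :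
    HasSum (herglotzKernel N p q y n)
      ((-(1 / 2) * (digammaPair ((((n : ℝ) + 1) ^ (N : ℝ) : ℝ) * y) +
          2 * Real.eulerMascheroniConstant +
          2 * (N * Real.log ((n : ℝ) + 1) + log y)) -
        ∑ i ∈ Finset.Icc 1 q, (-1) ^ i * (((n : ℂ) + 1) ^ (2 * N * i) * y ^ (2 * i)) *
          riemannZeta (2 * (i : ℂ) + 1)) / ((n : ℂ) + 1) ^ (2 * p + 1)) := by
  have hy0 : y ≠ 0 := by rintro rfl; simp at hy
  have hn : (n : ℂ) + 1 ≠ 0 := by exact_mod_cast Nat.succ_ne_zero n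
  have hpair := hasSum_digammaPair (z := (((n : ℝ) + 1) ^ (N : ℝ) : ℝ) * y)
    (by rw [re_ofReal_mul]; positivity)
  rw [log_natCast_add_one_rpow_mul hy0] at hpair
  have hz : ∀ i : ℕ, 1 ≤ i → HasSum (fun m : ℕ => 1 / ((m : ℂ) + 1) ^ (2 * i + 1))
      (riemannZeta (2 * (i : ℂ) + 1)) := by
    intro i hi
    have h := hasSum_zeta_real (a := ((2 * i + 1 : ℕ) : ℝ)) (by
      have : (1 : ℝ) ≤ i := by exact_mod_cast hi
      push_cast; linarith)
    simp_rw [Real.rpow_natCast] at h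
    push_cast at h
    exact h
  have hfin := hasSum_sum (s := Finset.Icc 1 q) fun i hi =>
    (hz i (Finset.mem_Icc.1 hi).1).mul_left ((-1) ^ i * (((n : ℂ) + 1) ^ (2 * N * i) * y ^ (2 * i)))
  have h := ((hpair.mul_left (-(1 / 2))).sub hfin).div_const (((n : ℂ) + 1) ^ (2 * p + 1))
  have hfun : herglotzKernel N p q y n = fun m : ℕ =>
      (-(1 / 2) * (2 / ((m : ℂ) + 1) * (((((n : ℝ) + 1) ^ (N : ℝ) : ℝ) * y) ^ 2 /
        (((m : ℂ) + 1) ^ 2 + ((((n : ℝ) + 1) ^ (N : ℝ) : ℝ) * y) ^ 2))) -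
      ∑ i ∈ Finset.Icc 1 q, (-1) ^ i * (((n : ℂ) + 1) ^ (2 * N * i) * y ^ (2 * i)) *
        (1 / ((m : ℂ) + 1) ^ (2 * i + 1))) / ((n : ℂ) + 1) ^ (2 * p + 1) := by
    funext m
    have hm : (m : ℂ) + 1 ≠ 0 := by exact_mod_cast Nat.succ_ne_zero m
    have ht1 : herglotzRatio N y n m * ((m : ℂ) + 1) = (((n : ℝ) + 1) ^ (N : ℝ) : ℝ) * y := by
      rw [herglotzRatio, Real.rpow_natCast]
      push_cast
      field_simp
    have hne : 1 + herglotzRatio N y n m ^ 2 ≠ 0 := by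
      have h1 := sq_mem_slitPlane hy
      have h2 : herglotzRatio N y n m ^ 2 =
          (((((n : ℝ) + 1) ^ N / ((m : ℝ) + 1)) ^ 2 : ℝ) : ℂ) * y ^ 2 := by
        rw [herglotzRatio]; push_cast; ring
      intro h0
      have h3 := ofReal_mul_mem_slitPlane
        (t := (((n : ℝ) + 1) ^ N / ((m : ℝ) + 1)) ^ 2) (by positivity) h1
      rw [← h2, show herglotzRatio N y n m ^ 2 = -((1 : ℕ) : ℂ) by
        push_cast; linear_combination h0] at h3
      exact ne_neg_natCast_of_mem_slitPlane h3 1 rfl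
    have hsum : ∑ i ∈ Finset.Icc 1 q, (-1) ^ i * (((n : ℂ) + 1) ^ (2 * N * i) * y ^ (2 * i)) *
        (1 / ((m : ℂ) + 1) ^ (2 * i + 1)) =
        (∑ i ∈ Finset.Icc 1 q, (-herglotzRatio N y n m ^ 2) ^ i) / ((m : ℂ) + 1) := by
      rw [Finset.sum_div]
      refine Finset.sum_congr rfl fun i _ => ?_
      rw [neg_pow (herglotzRatio N y n m ^ 2), ← pow_mul, herglotzRatio, div_pow, mul_pow, ← pow_mul,
        show N * (2 * i) = 2 * N * i by ring]
      field_simp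
      ring
    have hgeom : ∑ i ∈ Finset.Icc 1 q, (-herglotzRatio N y n m ^ 2) ^ i =
        (1 - (-herglotzRatio N y n m ^ 2) ^ (q + 1)) / (1 + herglotzRatio N y n m ^ 2) - 1 := by
      have h1 := geom_sum_mul_neg (-herglotzRatio N y n m ^ 2) (q + 1)
      rw [Finset.sum_range_succ'] at h1
      have h2 : ∑ i ∈ Finset.Icc 1 q, (-herglotzRatio N y n m ^ 2) ^ i =
          ∑ i ∈ Finset.range q, (-herglotzRatio N y n m ^ 2) ^ (i + 1) := by
        rw [Finset.range_eq_Ico, Finset.sum_Ico_add' (fun i => (-herglotzRatio N y n m ^ 2) ^ i)]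
        rfl
      rw [h2, eq_sub_iff_add_eq, eq_div_iff hne]
      linear_combination h1
    rw [hsum, hgeom, ← ht1, herglotzKernel]
    have hne2 : ((m : ℂ) + 1) ^ 2 + (herglotzRatio N y n m * ((m : ℂ) + 1)) ^ 2 =
        ((m : ℂ) + 1) ^ 2 * (1 + herglotzRatio N y n m ^ 2) := by ring
    rw [hne2]
    generalize (-herglotzRatio N y n m ^ 2) ^ (q + 1) = u
    generalize herglotzRatio N y n m = t at hne
    field_simp
    ring
  rw [hfun]
  exact h

theorem tsum_herglotzKernel {N p q r : ℕ} (hN : N ≠ 0) (hr : 1 ≤ r) (hp : p = N * q + r) {y : ℂ}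
    (hy : 0 < y.re) :
    ∑' nm : ℕ × ℕ, herglotzKernel N p q y nm.1 nm.2 =
      -(1 / 2) * (extHerglotz ((2 * p + 1 : ℕ) : ℝ) N (I * y) +
        extHerglotz ((2 * p + 1 : ℕ) : ℝ) N (-I * y)) -
        (Real.eulerMascheroniConstant + log y) * riemannZeta ((2 * p + 1 : ℕ) : ℂ) +
        N * deriv riemannZeta ((2 * p + 1 : ℕ) : ℂ) -
        ∑ i ∈ Finset.Icc 1 q, (-1) ^ i * y ^ (2 * i) * riemannZeta (2 * (i : ℂ) + 1) *
          riemannZeta (((2 * p + 1 : ℕ) : ℂ) - 2 * N * i) := by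
  have hS := summable_herglotzKernel hN hr hp hy
  have h1 := hS.hasSum.prod_fiberwise fun n => hasSum_herglotzKernel_right p q hy n
  refine h1.unique ?_
  have hk1 : (1 : ℝ) < ((2 * p + 1 : ℕ) : ℝ) := by
    have : 1 ≤ p := by rw [hp]; exact hr.trans (Nat.le_add_left _ _)
    exact_mod_cast (by omega : 1 < 2 * p + 1)
  have hF := extHerglotz_add_extHerglotz hk1 (b := N) (by positivity) hy
  have hz := hasSum_zeta_real hk1
  have hlz := hasSum_log_zeta_deriv_real hk1
  have hfin := hasSum_sum (L := SummationFilter.unconditional ℕ) (s := Finset.Icc 1 q)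
    (f := fun (i n : ℕ) => (-1) ^ i * y ^ (2 * i) * riemannZeta (2 * (i : ℂ) + 1) *
      (1 / (((n : ℝ) + 1) ^ (((2 * p + 1 : ℕ) : ℝ) - 2 * N * i) : ℝ)))
    (a := fun i : ℕ => (-1) ^ i * y ^ (2 * i) * riemannZeta (2 * (i : ℂ) + 1) *
          riemannZeta (((2 * p + 1 : ℕ) : ℂ) - 2 * N * i)) fun i hi => by
      refine HasSum.mul_left _ ?_
      -- From i ≤ q and r ≥ 1, Ni < p, so each ζ(k-2Ni) is still given by its convergent series.
      have h2 : (1 : ℝ) < ((2 * p + 1 : ℕ) : ℝ) - 2 * N * i := by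
        have h3 : N * i ≤ N * q := Nat.mul_le_mul_left _ (Finset.mem_Icc.1 hi).2
        have h4 : (N : ℝ) * i < p := by exact_mod_cast (by omega : N * i < p)
        push_cast
        linarith
      have h3 := hasSum_zeta_real h2
      push_cast at h3 ⊢
      exact h3
  have h := (((hF.mul_left (-(1 / 2))).sub
    (hz.mul_left ((Real.eulerMascheroniConstant : ℂ) + log y))).sub (hlz.mul_left (N : ℂ))).sub hfin
  refine h.of_eq (fun n => ?_) ?_
  · have hn : (n : ℂ) + 1 ≠ 0 := by exact_mod_cast Nat.succ_ne_zero n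
    have hn' : (0 : ℝ) < (n : ℝ) + 1 := by positivity
    have hterm : ∀ i ∈ Finset.Icc 1 q, (-1) ^ i * y ^ (2 * i) * riemannZeta (2 * (i : ℂ) + 1) *
        (1 / (((n : ℝ) + 1) ^ (((2 * p + 1 : ℕ) : ℝ) - 2 * N * i) : ℝ)) =
        (-1) ^ i * (((n : ℂ) + 1) ^ (2 * N * i) * y ^ (2 * i)) *
          riemannZeta (2 * (i : ℂ) + 1) / ((n : ℂ) + 1) ^ (2 * p + 1) := by
      intro i _
      have h5 : (2 * N * i : ℝ) = ((2 * N * i : ℕ) : ℝ) := by push_cast; ring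
      rw [h5, Real.rpow_sub hn', Real.rpow_natCast, Real.rpow_natCast]
      push_cast
      field_simp
    rw [Finset.sum_congr rfl hterm, ← Finset.sum_div, Real.rpow_natCast _ (2 * p + 1)]
    push_cast
    field_simp
    ring
  · rw [ofReal_natCast]
    ring

/-! ### The double series, summed over n first -/

/-- With A = n^{2N} and B = (μη)^{2N}, where η stands for y^{-1/N}, t² = A/B and both sides reduce
to the same monomial over A + B. The signs agree because N is odd: p + q + 1 = (N+1)q + r + 1 has
the parity of r + 1. -/
theorem herglotzKernel_transform {N p q r : ℕ} (hN : Odd N) (hrN : r ≤ N) (hp : p = N * q + r)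
    {c n M μ η y : ℂ} (hn : n ≠ 0) (hμ : μ ≠ 0) (hη : η ≠ 0) (hM : M = μ ^ N) (hy : y * η ^ N = 1)
    (hD : (n ^ 2) ^ N + (μ ^ 2 * η ^ 2) ^ N ≠ 0) :
    2 / n * -(c * (-(μ ^ 2 * η ^ 2)) ^ r * (n ^ 2) ^ (N - r) /
        ((n ^ 2) ^ N + (μ ^ 2 * η ^ 2) ^ N)) / (M * μ ^ (2 * p)) =
      2 * c * (-1) ^ p * η ^ (2 * p) * ((-(n ^ N * y / M) ^ 2) ^ (q + 1) / (1 + (n ^ N * y / M) ^ 2) /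
        (n ^ (2 * p + 1) * M)) := by
  have hsign : (-1 : ℂ) ^ p * (-1) ^ (q + 1) = -(-1) ^ r := by
    have h1 : (-1 : ℂ) ^ (q * q.succ) = 1 := (Nat.even_mul_succ_self q).neg_one_pow
    obtain ⟨l, rfl⟩ := hN
    rw [hp, ← pow_add, show (2 * l + 1) * q + r + (q + 1) = 2 * ((l + 1) * q) + (r + 1) by ring,
      pow_add, pow_mul, neg_one_sq, one_pow]
    ring
  have hηN : η ^ N ≠ 0 := pow_ne_zero _ hη
  have hμN : μ ^ N ≠ 0 := pow_ne_zero _ hμ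
  have ht : (n ^ N * y / M) ^ 2 = (n ^ 2) ^ N / (μ ^ 2 * η ^ 2) ^ N := by
    rw [hM, eq_div_of_mul_eq hηN hy, mul_pow, ← pow_mul, ← pow_mul, ← pow_mul, mul_comm 2 N, pow_mul,
      pow_mul, pow_mul]
    field_simp
  obtain ⟨B, hB⟩ : ∃ B, B = (μ ^ 2 * η ^ 2) ^ N := ⟨_, rfl⟩
  obtain ⟨A, hA⟩ : ∃ A, A = (n ^ 2) ^ N := ⟨_, rfl⟩
  have hB0 : B ≠ 0 := by
    rw [hB]; exact pow_ne_zero _ (mul_ne_zero (pow_ne_zero _ hμ) (pow_ne_zero _ hη))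
  rw [← hA, ← hB] at hD ht
  rw [ht, ← hA, ← hB]
  have h1 : 1 + A / B = (A + B) / B := by field_simp; ring
  have hs : (n ^ 2) ^ (N - r) * (n ^ 2) ^ r = A := by
    rw [hA, ← pow_add, Nat.sub_add_cancel hrN]
  have hnp : n ^ (2 * p + 1) = A ^ q * (n ^ 2) ^ r * n := by rw [hp, hA]; ring
  have hmp : μ ^ (2 * p) * η ^ (2 * p) = B ^ q * (μ ^ 2 * η ^ 2) ^ r := by rw [hp, hB]; ring
  have hA0 : A ≠ 0 := by rw [hA]; exact pow_ne_zero _ (pow_ne_zero _ hn)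
  have hM0 : M ≠ 0 := by rw [hM]; exact hμN
  have hμp : μ ^ (2 * p) ≠ 0 := pow_ne_zero _ hμ
  have hnr : (n ^ 2) ^ r ≠ 0 := pow_ne_zero _ (pow_ne_zero _ hn)
  rw [h1, hnp, neg_pow (A / B), neg_pow (μ ^ 2 * η ^ 2), div_pow, eq_div_of_mul_eq hnr hs]
  have h2 : η ^ (2 * p) = B ^ q * (μ ^ 2 * η ^ 2) ^ r / μ ^ (2 * p) :=
    eq_div_of_mul_eq hμp (by linear_combination hmp)
  rw [h2]
  generalize (μ ^ 2 * η ^ 2) ^ r = v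
  calc _ = 2 * c * -(-1) ^ r * (v * A / ((n ^ 2) ^ r * n * (A + B) * M * μ ^ (2 * p))) := by
        field_simp
    _ = _ := by
        rw [← hsign]
        field_simp
        ring

theorem herglotzPoint_eq_exp {N : ℕ} {x : ℂ} (hx : 0 < x.re) (m : ℕ) :
    herglotzPoint N x (2 * (m : ℤ) - ((N : ℤ) - 1)) =
      exp (-(log (x / (2 * (Real.pi : ℂ))) / N)) * stepExp N ((Real.pi : ℂ) / (2 * N)) m := by
  have hy : 0 < (x / (2 * (Real.pi : ℂ))).re := by
    rw [show (2 * (Real.pi : ℂ)) = ((2 * Real.pi : ℝ) : ℂ) by push_cast; ring, div_ofReal_re]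
    positivity
  have hx0 : 2 * (Real.pi : ℂ) / x ≠ 0 := by
    refine div_ne_zero (mul_ne_zero two_ne_zero (by exact_mod_cast Real.pi_ne_zero)) ?_
    rintro rfl; simp at hx
  rw [herglotzPoint, cpow_def_of_ne_zero hx0, ← inv_div x, log_inv _ (slitPlane_arg_ne_pi (Or.inl hy)),
    stepExp]
  congr 2
  · ring
  · push_cast; ring

theorem stepExp_sq (N : ℕ) (m : ℕ) :
    stepExp N ((Real.pi : ℂ) / (2 * N)) m ^ 2 = stepExp N ((Real.pi : ℂ) / N) m := by
  rw [stepExp, stepExp, ← exp_nat_mul]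
  congr 1
  push_cast
  ring

/-- The imaginary part is (-arg y + jπ/2)/N with |arg y| < π/2 and |j| ≤ N-1. Hence every point lies
in the right half-plane and its principal logarithm is the exponent itself. -/
theorem abs_im_lt_pi_div_two {N m : ℕ} (hm : m < N) {y : ℂ} (hy : 0 < y.re) :
    |(-(log y / N) + I * (2 * (m : ℂ) - ((N : ℂ) - 1)) * ((Real.pi : ℂ) / (2 * N))).im| <
      Real.pi / 2 := by
  have harg := abs_lt.1 (abs_arg_lt_pi_div_two_iff.2 (Or.inl hy))
  have hN : (0 : ℝ) < N := by exact_mod_cast (by omega : 0 < N)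
  have h1 : (-(log y / N) + I * (2 * (m : ℂ) - ((N : ℂ) - 1)) * ((Real.pi : ℂ) / (2 * N))) =
      -(log y / (N : ℝ)) + I * (((2 * (m : ℝ) - ((N : ℝ) - 1)) * (Real.pi / (2 * N)) : ℝ) : ℂ) := by
    push_cast; ring
  rw [h1, add_im, neg_im, div_ofReal_im, log_im, I_mul_im, ofReal_re]
  have h2 : -(arg y / N) + (2 * (m : ℝ) - ((N : ℝ) - 1)) * (Real.pi / (2 * N)) =
      (-arg y + (2 * (m : ℝ) - ((N : ℝ) - 1)) * (Real.pi / 2)) / N := by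
    field_simp
  have h3 : (m : ℝ) + 1 ≤ N := by exact_mod_cast hm
  have h4 : (0 : ℝ) ≤ m := Nat.cast_nonneg m
  have hpi := Real.pi_pos
  rw [h2, abs_div, abs_of_pos hN, div_lt_iff₀ hN, abs_lt]
  constructor <;> nlinarith

theorem exp_re_pos {w : ℂ} (hw : |w.im| < Real.pi / 2) : 0 < (exp w).re := by
  rw [exp_re]
  exact mul_pos (Real.exp_pos _) (Real.cos_pos_of_mem_Ioo (abs_lt.1 hw))

theorem log_exp_of_abs_im_lt {w : ℂ} (hw : |w.im| < Real.pi / 2) : log (exp w) = w := by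
  have h := abs_lt.1 hw
  exact log_exp (by linarith [Real.pi_pos]) (by linarith [Real.pi_pos])

section Point

variable {N m : ℕ} {x : ℂ}

theorem herglotzPoint_eq_exp' (hx : 0 < x.re) :
    herglotzPoint N x (2 * (m : ℤ) - ((N : ℤ) - 1)) =
      exp (-(log (x / (2 * (Real.pi : ℂ))) / N) +
        I * (2 * (m : ℂ) - ((N : ℂ) - 1)) * ((Real.pi : ℂ) / (2 * N))) := by
  rw [herglotzPoint_eq_exp hx, stepExp, exp_add]

theorem div_two_pi_re_pos (hx : 0 < x.re) : 0 < (x / (2 * (Real.pi : ℂ))).re := by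
  rw [show (2 * (Real.pi : ℂ)) = ((2 * Real.pi : ℝ) : ℂ) by push_cast; ring, div_ofReal_re]
  positivity

theorem herglotzPoint_re_pos (hx : 0 < x.re) (hm : m < N) :
    0 < (herglotzPoint N x (2 * (m : ℤ) - ((N : ℤ) - 1))).re := by
  rw [herglotzPoint_eq_exp' hx]
  exact exp_re_pos (abs_im_lt_pi_div_two hm (div_two_pi_re_pos hx))

theorem log_herglotzPoint (hx : 0 < x.re) (hm : m < N) :
    log (herglotzPoint N x (2 * (m : ℤ) - ((N : ℤ) - 1))) =
      -(log (x / (2 * (Real.pi : ℂ))) / N) +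
        I * (2 * (m : ℂ) - ((N : ℂ) - 1)) * ((Real.pi : ℂ) / (2 * N)) := by
  rw [herglotzPoint_eq_exp' hx,
    log_exp_of_abs_im_lt (abs_im_lt_pi_div_two hm (div_two_pi_re_pos hx))]

end Point

theorem rpow_one_add_div {N : ℕ} (hN : N ≠ 0) (p : ℕ) {t : ℝ} (ht : 0 < t) :
    t ^ (((N : ℝ) + (2 * p + 1 : ℕ) - 1) / N) = t * (t ^ (1 / (N : ℝ))) ^ (2 * p) := by
  have hN1 : (N : ℝ) ≠ 0 := by exact_mod_cast hN
  rw [show ((N : ℝ) + (2 * p + 1 : ℕ) - 1) / N = 1 + 1 / (N : ℝ) * (2 * p : ℕ) by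
    push_cast; field_simp; ring, Real.rpow_add ht, Real.rpow_one, Real.rpow_mul ht.le,
    Real.rpow_natCast]

/-- The squares of the N points are η² times the N-th roots of unity, so the weighted sum of the
digamma pair expansions collapses by partial fractions with a = (n+1)² and v = (l+1)^{2/N}η². -/
theorem hasSum_herglotzKernel_left {N p q r : ℕ} (hN : Odd N) (hr : 1 ≤ r) (hrN : r ≤ N)
    (hp : p = N * q + r) {x : ℂ} (hx : 0 < x.re) (l : ℕ) :
    HasSum (fun n : ℕ => 2 * N * (-1) ^ p *
        exp (-(log (x / (2 * (Real.pi : ℂ))) / N)) ^ (2 * p) *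
        herglotzKernel N p q (x / (2 * (Real.pi : ℂ))) n l)
      ((∑ m ∈ Finset.range N, (stepExp N ((Real.pi : ℂ) / N) m ^ p)⁻¹ *
        (digammaPair ((((l : ℝ) + 1) ^ (1 / (N : ℝ)) : ℝ) *
            herglotzPoint N x (2 * (m : ℤ) - ((N : ℤ) - 1))) +
          2 * Real.eulerMascheroniConstant +
          2 * (Real.log ((l : ℝ) + 1) / N + (-(log (x / (2 * (Real.pi : ℂ))) / N) +
            I * (2 * (m : ℂ) - ((N : ℂ) - 1)) * ((Real.pi : ℂ) / (2 * N)))))) /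
        (((l : ℝ) + 1) ^ (((N : ℝ) + (2 * p + 1 : ℕ) - 1) / N) : ℝ)) := by
  have hN0 : N ≠ 0 := by rintro rfl; simp at hN
  have hNC : (N : ℂ) ≠ 0 := Nat.cast_ne_zero.2 hN0
  have hy := div_two_pi_re_pos hx
  have hl : (0 : ℝ) < (l : ℝ) + 1 := by positivity
  have h := (hasSum_sum (L := SummationFilter.unconditional ℕ) (s := Finset.range N) fun m hm =>
    (hasSum_digammaPair (z := (((l : ℝ) + 1) ^ (1 / (N : ℝ)) : ℝ) *
      herglotzPoint N x (2 * (m : ℤ) - ((N : ℤ) - 1))) (by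
        rw [re_ofReal_mul]
        exact mul_pos (by positivity) (herglotzPoint_re_pos hx (Finset.mem_range.1 hm)))).mul_left
      (stepExp N ((Real.pi : ℂ) / N) m ^ p)⁻¹).div_const
        ((((l : ℝ) + 1) ^ (((N : ℝ) + (2 * p + 1 : ℕ) - 1) / N) : ℝ) : ℂ)
  refine h.of_eq (fun n => ?_) ?_
  · obtain ⟨y, hyy⟩ : ∃ y, y = x / (2 * (Real.pi : ℂ)) := ⟨_, rfl⟩
    obtain ⟨η, hη⟩ : ∃ η, η = exp (-(log y / N)) := ⟨_, rfl⟩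
    obtain ⟨μ, hμ⟩ : ∃ μ : ℝ, μ = ((l : ℝ) + 1) ^ (1 / (N : ℝ)) := ⟨_, rfl⟩
    have hμ0 : 0 < μ := by rw [hμ]; positivity
    have hμN : μ ^ N = (l : ℝ) + 1 := by
      rw [hμ, ← Real.rpow_natCast, ← Real.rpow_mul hl.le]
      have : (N : ℝ) ≠ 0 := by exact_mod_cast hN0
      rw [one_div_mul_cancel this, Real.rpow_one]
    rw [← hyy] at hy
    have hy0 : y ≠ 0 := by rintro rfl; simp at hy
    have hηy : y * η ^ N = 1 := by
      rw [hη, ← exp_nat_mul, show (N : ℂ) * -(log y / N) = -log y by field_simp, exp_neg,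
        exp_log hy0, mul_inv_cancel₀ hy0]
    have hη0 : η ≠ 0 := by rw [hη]; exact exp_ne_zero _
    have hn : (n : ℂ) + 1 ≠ 0 := by exact_mod_cast Nat.succ_ne_zero n
    -- A zero would make a positive multiple of y² a negative real, impossible for Re y > 0.
    have hD : (((n : ℂ) + 1) ^ 2) ^ N + ((μ : ℂ) ^ 2 * η ^ 2) ^ N ≠ 0 := by
      intro h0
      have h1 : ((n : ℂ) + 1) ^ (2 * N) * y ^ 2 = -((l : ℂ) + 1) ^ 2 := by
        have h2 : ((μ : ℂ) ^ 2 * η ^ 2) ^ N = ((l : ℂ) + 1) ^ 2 * (η ^ N) ^ 2 := by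
          rw [mul_pow, ← pow_mul, mul_comm 2 N, pow_mul, ← ofReal_pow, hμN]
          push_cast
          ring
        rw [h2, ← pow_mul] at h0
        linear_combination y ^ 2 * h0 - ((l : ℂ) + 1) ^ 2 * (y * η ^ N + 1) * hηy
      have h3 := ofReal_mul_mem_slitPlane (t := ((n : ℝ) + 1) ^ (2 * N)) (by positivity)
        (sq_mem_slitPlane hy)
      push_cast at h3
      rw [h1] at h3
      refine ne_neg_natCast_of_mem_slitPlane h3 ((l + 1) ^ 2) ?_
      push_cast; ring
    have hpf := sum_stepExp_partial_fraction (q := q) hN hr hrN (((n : ℂ) + 1) ^ 2)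
      ((μ : ℂ) ^ 2 * η ^ 2) hD
    have htr := herglotzKernel_transform (c := N) hN hrN hp hn (by exact_mod_cast hμ0.ne' : (μ : ℂ) ≠ 0)
      hη0 (M := (l : ℂ) + 1) (by rw [← ofReal_pow, hμN]; push_cast; ring) hηy hD
    rw [← hyy, ← hη, herglotzKernel, herglotzRatio, ← htr, ← hpf, rpow_one_add_div hN0 p hl, ← hμ,
      Finset.mul_sum, hp]
    push_cast
    congr 1
    refine Finset.sum_congr rfl fun m _ => ?_
    rw [herglotzPoint_eq_exp hx, ← hyy, ← hη, mul_pow (μ : ℂ), mul_pow η, stepExp_sq]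
    ring
  · congr 1
    refine Finset.sum_congr rfl fun m hm => ?_
    have hne : herglotzPoint N x (2 * (m : ℤ) - ((N : ℤ) - 1)) ≠ 0 := by
      rw [herglotzPoint_eq_exp' hx]; exact exp_ne_zero _
    rw [log_natCast_add_one_rpow_mul hne, log_herglotzPoint hx (Finset.mem_range.1 hm)]
    push_cast
    ring

theorem exp_eq_stepExp_pow_inv (N p m : ℕ) :
    exp (-(I * Real.pi * (((2 * p + 1 : ℕ) : ℂ) - 1) * ((2 * (m : ℤ) - ((N : ℤ) - 1) : ℤ) : ℂ) /
      (2 * N))) = (stepExp N ((Real.pi : ℂ) / N) m ^ p)⁻¹ := by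
  rw [stepExp, ← exp_nat_mul, ← exp_neg]
  congr 1
  push_cast
  ring

/-- Absolute convergence permits the exchange of summations. Summing 2γ + 2 log z against
(l+1)^{-(N+k-1)/N} then splits off the ζ and ζ' terms. -/
theorem stepTwoSum_extHerglotz {N p q r : ℕ} (hN : Odd N) (hr : 1 ≤ r) (hrN : r ≤ N)
    (hp : p = N * q + r) {x : ℂ} (hx : 0 < x.re) :
    stepTwoSum N (fun j =>
        exp (-(I * Real.pi * (((2 * p + 1 : ℕ) : ℂ) - 1) * j / (2 * N))) *
          (extHerglotz (((N : ℝ) + (2 * p + 1 : ℕ) - 1) / N) (1 / (N : ℝ)) (I * herglotzPoint N x j) +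
            extHerglotz (((N : ℝ) + (2 * p + 1 : ℕ) - 1) / N) (1 / (N : ℝ))
              (-I * herglotzPoint N x j))) =
      2 * N * (-1) ^ p * exp (-(log (x / (2 * (Real.pi : ℂ))) / N)) ^ (2 * p) *
          ∑' nm : ℕ × ℕ, herglotzKernel N p q (x / (2 * (Real.pi : ℂ))) nm.1 nm.2 -
        (((∑ m ∈ Finset.range N, (stepExp N ((Real.pi : ℂ) / N) m ^ p)⁻¹) *
            (2 * Real.eulerMascheroniConstant - 2 * log (x / (2 * (Real.pi : ℂ))) / N) +
          Real.pi / N * ∑ m ∈ Finset.range N, I * (2 * (m : ℂ) - ((N : ℂ) - 1)) *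
            (stepExp N ((Real.pi : ℂ) / N) m ^ p)⁻¹) *
          riemannZeta ((((N : ℝ) + (2 * p + 1 : ℕ) - 1) / N : ℝ) : ℂ) -
        2 / N * (∑ m ∈ Finset.range N, (stepExp N ((Real.pi : ℂ) / N) m ^ p)⁻¹) *
          deriv riemannZeta ((((N : ℝ) + (2 * p + 1 : ℕ) - 1) / N : ℝ) : ℂ)) := by
  have hN0 : N ≠ 0 := by rintro rfl; simp at hN
  have hNpos : (0 : ℝ) < N := by exact_mod_cast Nat.pos_of_ne_zero hN0
  have hp1 : (1 : ℝ) ≤ p := by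
    have : 1 ≤ p := by rw [hp]; exact hr.trans (Nat.le_add_left _ _)
    exact_mod_cast this
  obtain ⟨a, ha⟩ : ∃ a : ℝ, a = ((N : ℝ) + (2 * p + 1 : ℕ) - 1) / N := ⟨_, rfl⟩
  have ha1 : 1 < a := by
    rw [ha, lt_div_iff₀ hNpos]; push_cast; linarith
  have hS := summable_herglotzKernel hN0 hr hp (div_two_pi_re_pos hx)
  have hS' := (Equiv.prodComm ℕ ℕ).hasSum_iff.2 (hS.hasSum.mul_left
    (2 * N * (-1) ^ p * exp (-(log (x / (2 * (Real.pi : ℂ))) / N)) ^ (2 * p)))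
  have hcol := hS'.prod_fiberwise fun l => hasSum_herglotzKernel_left hN hr hrN hp hx l
  have hlhs := hasSum_sum (L := SummationFilter.unconditional ℕ) (s := Finset.range N)
    fun m hm => (extHerglotz_add_extHerglotz ha1 (one_div_pos.2 hNpos)
      (herglotzPoint_re_pos hx (Finset.mem_range.1 hm))).mul_left
        (stepExp N ((Real.pi : ℂ) / N) m ^ p)⁻¹
  have hz := (hasSum_zeta_real ha1).mul_left
    ((∑ m ∈ Finset.range N, (stepExp N ((Real.pi : ℂ) / N) m ^ p)⁻¹) *
            (2 * Real.eulerMascheroniConstant - 2 * log (x / (2 * (Real.pi : ℂ))) / N) +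
          Real.pi / N * ∑ m ∈ Finset.range N, I * (2 * (m : ℂ) - ((N : ℂ) - 1)) *
            (stepExp N ((Real.pi : ℂ) / N) m ^ p)⁻¹)
  have hlz := (hasSum_log_zeta_deriv_real ha1).mul_left
    (2 / N * (∑ m ∈ Finset.range N, (stepExp N ((Real.pi : ℂ) / N) m ^ p)⁻¹))
  have htot := (hlhs.add (hz.add hlz)).unique (hcol.of_eq (fun l => ?_) rfl)
  · rw [← ha, stepTwoSum]
    simp_rw [exp_eq_stepExp_pow_inv]
    linear_combination htot
  · rw [← ha]
    simp only [Finset.mul_sum, Finset.sum_mul, Finset.sum_div, ← Finset.sum_add_distrib]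
    refine Finset.sum_congr rfl fun m _ => ?_
    ring

/-! ### The two cases of 𝓒 and the final comparison -/

theorem herglotzZetaSum_eq (k N : ℕ) (x : ℂ) (M : ℕ) :
    herglotzZetaSum k N x M = 2 * ∑ i ∈ Finset.Icc 1 M, (-1) ^ i *
      (x / (2 * (Real.pi : ℂ))) ^ (2 * i) * riemannZeta (2 * (i : ℂ) + 1) *
        riemannZeta ((k : ℂ) - 2 * N * i) := by
  have hpi : (Real.pi : ℂ) ≠ 0 := by exact_mod_cast Real.pi_ne_zero
  rw [herglotzZetaSum, Finset.mul_sum, Finset.mul_sum]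
  refine Finset.sum_congr rfl fun i _ => ?_
  rw [show (-2 * (i : ℤ) - 1) = -((2 * i + 1 : ℕ) : ℤ) by push_cast; ring, zpow_neg, zpow_natCast,
    div_pow]
  field_simp
  ring

theorem sum_two_mul_sub (N : ℕ) :
    ∑ m ∈ Finset.range N, (2 * (m : ℂ) - ((N : ℂ) - 1)) = 0 := by
  have h : ∀ M : ℕ, ∑ m ∈ Finset.range M, (2 * (m : ℂ) - ((N : ℂ) - 1)) = M * (M - N) := by
    intro M
    induction M with
    | zero => simp
    | succ M ih => rw [Finset.sum_range_succ, ih]; push_cast; ring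
  rw [h, sub_self, mul_zero]

/-- As k = 2p+1, ⌊k/(2N)⌋ = ⌊p/N⌋, so the case condition says p = N⌊p/N⌋. -/
theorem cast_div_eq_iff_dvd {N : ℕ} (hN : N ≠ 0) (p : ℕ) :
    (1 - ((2 * p + 1 : ℕ) : ℚ)) / (N : ℚ) = -2 * (((2 * p + 1) / (2 * N) : ℕ) : ℚ) ↔ N ∣ p := by
  have h1 : (2 * p + 1) / (2 * N) = p / N := by
    rw [← Nat.div_div_eq_div_mul]
    congr 1
    omega
  have hNQ : (N : ℚ) ≠ 0 := by exact_mod_cast hN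
  rw [h1, div_eq_iff hNQ]
  push_cast
  constructor
  · intro h
    refine ⟨p / N, ?_⟩
    have h2 : (p : ℚ) = N * (p / N : ℕ) := by linear_combination (-1 / 2) * h
    exact_mod_cast h2
  · rintro ⟨c, rfl⟩
    rw [Nat.mul_div_cancel_left _ (Nat.pos_of_ne_zero hN)]
    push_cast
    ring

theorem sum_stepExp_inv_pow {N : ℕ} (hN : Odd N) (p : ℕ) :
    ∑ m ∈ Finset.range N, (stepExp N ((Real.pi : ℂ) / N) m ^ p)⁻¹ =
      if N ∣ p then (N : ℂ) else 0 := by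
  have h := sum_stepExp_zpow hN (-(p : ℤ))
  simp_rw [zpow_neg, zpow_natCast, Int.dvd_neg, Int.natCast_dvd_natCast] at h
  exact h

theorem herglotzC_of_not_dvd {N p q r : ℕ} (hN : N ≠ 0) (hrN : r ≤ N)
    (hp : p = N * q + r) (h : ¬ N ∣ p) (x : ℂ) :
    herglotzC (2 * p + 1) N x =
      -(Real.pi * riemannZeta ((((N : ℝ) + (2 * p + 1 : ℕ) - 1) / N : ℝ) : ℂ) /
        (N * sin ((Real.pi : ℂ) * p / N)) *
        (x / (2 * (Real.pi : ℂ))) ^ ((((2 * p + 1 : ℕ) : ℂ) - 1) / N)) +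
      herglotzZetaSum (2 * p + 1) N x q := by
  have hrN' : r < N := lt_of_le_of_ne hrN (by
    rintro rfl
    exact h ⟨q + 1, by rw [hp]; ring⟩)
  have h1 : (2 * p + 1) / (2 * N) = q := by
    rw [← Nat.div_div_eq_div_mul, show (2 * p + 1) / 2 = N * q + r by omega,
      Nat.mul_add_div (Nat.pos_of_ne_zero hN), Nat.div_eq_of_lt hrN', add_zero]
  have hNC : (N : ℂ) ≠ 0 := Nat.cast_ne_zero.2 hN
  rw [herglotzC, if_pos (by rwa [Ne, cast_div_eq_iff_dvd hN]), h1]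
  have h2 : (Real.pi : ℂ) / (2 * N) * (1 - ((2 * p + 1 : ℕ) : ℂ)) = -((Real.pi : ℂ) * p / N) := by
    push_cast; field_simp; ring
  rw [h2, sin_neg]
  push_cast
  ring

/-- Here r = N and ⌊k/(2N)⌋ = q+1, so the upper limit ⌊k/(2N)⌋ - 1 is again q, matching the other
case. -/
theorem herglotzC_of_dvd {N p q : ℕ} (hN : N ≠ 0) (hp : p = N * (q + 1)) (x : ℂ) :
    herglotzC (2 * p + 1) N x =
      2 * (-1 : ℂ) ^ (q + 1) / N *
        (x / (2 * (Real.pi : ℂ))) ^ ((((2 * p + 1 : ℕ) : ℂ) - 1) / N) *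
        (((N : ℂ) * (Real.eulerMascheroniConstant : ℂ) + log (2 * (Real.pi : ℂ) / x)) *
            riemannZeta ((((N : ℝ) + (2 * p + 1 : ℕ) - 1) / N : ℝ) : ℂ) -
          deriv riemannZeta ((((N : ℝ) + (2 * p + 1 : ℕ) - 1) / N : ℝ) : ℂ)) +
      herglotzZetaSum (2 * p + 1) N x q := by
  have h1 : (2 * p + 1) / (2 * N) = q + 1 := by
    rw [← Nat.div_div_eq_div_mul, show (2 * p + 1) / 2 = N * (q + 1) by omega,
      Nat.mul_div_cancel_left _ (Nat.pos_of_ne_zero hN)]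
  have h2 : (2 * p + 1 - 1) / (2 * N) = q + 1 := by
    rw [Nat.add_sub_cancel, Nat.mul_div_mul_left _ _ two_pos, hp,
      Nat.mul_div_cancel_left _ (Nat.pos_of_ne_zero hN)]
  have hNC : (N : ℂ) ≠ 0 := Nat.cast_ne_zero.2 hN
  have h3 : 1 + (((2 * p + 1 : ℕ) : ℂ) - 1) / N =
      ((((N : ℝ) + (2 * p + 1 : ℕ) - 1) / N : ℝ) : ℂ) := by
    push_cast; field_simp; ring
  rw [herglotzC, if_neg (by rw [not_not, cast_div_eq_iff_dvd hN]; exact ⟨_, hp⟩), h1, h2, h3,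
    Nat.add_sub_cancel]

theorem theorem2p2 (k N : ℕ) (hk : Odd k) (hN : Odd N) (hk1 : k ≠ 1) (x : ℂ) (hx : 0 < x.re) :
    (∀ m ∈ Finset.range N, ∀ ε ∈ ({I, -I} : Set ℂ),
      Summable (extHerglotzTerm (((N : ℝ) + k - 1) / N) (1 / (N : ℝ))
        (ε * herglotzPoint N x (2 * (m : ℤ) - ((N : ℤ) - 1))))) ∧
    (∀ ε ∈ ({I, -I} : Set ℂ),
      Summable (extHerglotzTerm (k : ℝ) (N : ℝ) (ε * x / (2 * (Real.pi : ℂ))))) ∧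
    stepTwoSum N (fun j =>
        exp (-(I * Real.pi * ((k : ℂ) - 1) * j / (2 * N))) *
          (extHerglotz (((N : ℝ) + k - 1) / N) (1 / (N : ℝ)) (I * herglotzPoint N x j) +
            extHerglotz (((N : ℝ) + k - 1) / N) (1 / (N : ℝ)) (-I * herglotzPoint N x j))) =
      (-1 : ℂ) ^ ((k + 1) / 2) * N * (2 * (Real.pi : ℂ) / x) ^ (((k : ℂ) - 1) / N) *
        (extHerglotz (k : ℝ) (N : ℝ) (I * x / (2 * (Real.pi : ℂ))) +
          extHerglotz (k : ℝ) (N : ℝ) (-I * x / (2 * (Real.pi : ℂ))) +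
          2 * (((Real.eulerMascheroniConstant : ℂ) - log (2 * (Real.pi : ℂ) / x)) *
              riemannZeta (k : ℂ) -
            N * deriv riemannZeta (k : ℂ)) +
          herglotzC k N x) := by
  have hN0 : N ≠ 0 := by rintro rfl; simp at hN
  have hNpos : (0 : ℝ) < N := by exact_mod_cast Nat.pos_of_ne_zero hN0
  have hNC : (N : ℂ) ≠ 0 := Nat.cast_ne_zero.2 hN0
  obtain ⟨p, rfl⟩ := hk
  have hp1 : 1 ≤ p := by omega
  have hpR : (1 : ℝ) ≤ p := by exact_mod_cast hp1
  have hy := div_two_pi_re_pos hx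
  refine ⟨fun m hm ε hε => ?_, fun ε hε => ?_, ?_⟩
  · refine summable_extHerglotzTerm ?_ (one_div_pos.2 hNpos) ?_
    · rw [lt_div_iff₀ hNpos]; push_cast; linarith
    · have h := herglotzPoint_re_pos hx (Finset.mem_range.1 hm)
      rcases hε with rfl | rfl
      · exact I_mul_mem_slitPlane h
      · exact neg_I_mul_mem_slitPlane h
  · rw [mul_div_assoc]
    refine summable_extHerglotzTerm ?_ hNpos ?_
    · push_cast; linarith
    · rcases hε with rfl | rfl
      · exact I_mul_mem_slitPlane hy
      · exact neg_I_mul_mem_slitPlane hy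
  -- The remainder is taken in 1, …, N, not 0, …, N-1: the double series needs r ≥ 1. Dividing p - 1
  -- by N achieves this.
  · obtain ⟨q, r, hr, hrN, hp⟩ : ∃ q r : ℕ, 1 ≤ r ∧ r ≤ N ∧ p = N * q + r := by
      refine ⟨(p - 1) / N, (p - 1) % N + 1, by omega, Nat.mod_lt _ (Nat.pos_of_ne_zero hN0), ?_⟩
      have := Nat.div_add_mod (p - 1) N
      omega
    rw [stepTwoSum_extHerglotz hN hr hrN hp hx, tsum_herglotzKernel hN0 hr hp hy,
      mul_div_assoc I, mul_div_assoc (-I)]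
    have hy0 : x / (2 * (Real.pi : ℂ)) ≠ 0 := by
      intro h0; rw [h0] at hy; simp at hy
    have hexp : exp (-(log (x / (2 * (Real.pi : ℂ))) / N)) ≠ 0 := exp_ne_zero _
    have hcpow : (x / (2 * (Real.pi : ℂ))) ^ ((((2 * p + 1 : ℕ) : ℂ) - 1) / N) =
        (exp (-(log (x / (2 * (Real.pi : ℂ))) / N)) ^ (2 * p))⁻¹ := by
      rw [cpow_def_of_ne_zero hy0, ← exp_nat_mul, ← exp_neg]
      congr 1
      push_cast
      ring
    have hlog : log (2 * (Real.pi : ℂ) / x) = -log (x / (2 * (Real.pi : ℂ))) := by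
      rw [← inv_div x, log_inv _ (slitPlane_arg_ne_pi (Or.inl hy))]
    have hcpow' : (2 * (Real.pi : ℂ) / x) ^ ((((2 * p + 1 : ℕ) : ℂ) - 1) / N) =
        exp (-(log (x / (2 * (Real.pi : ℂ))) / N)) ^ (2 * p) := by
      rw [cpow_def_of_ne_zero (by rw [← inv_div x]; exact inv_ne_zero hy0), hlog, ← exp_nat_mul]
      congr 1
      push_cast
      ring
    have hη : exp (-(log (x / (2 * (Real.pi : ℂ))) / N)) ^ (2 * p) ≠ 0 := pow_ne_zero _ hexp
    have hsgn : ((-1 : ℂ) ^ p) * (-1) ^ p = 1 := by rw [← mul_pow]; simp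
    rw [hcpow', hlog, show (2 * p + 1 + 1) / 2 = p + 1 by omega, pow_succ (-1 : ℂ) p,
      sum_stepExp_inv_pow hN]
    by_cases hd : N ∣ p
    · have hrN' : r = N := by
        refine Nat.le_antisymm hrN (Nat.le_of_dvd hr ?_)
        rw [hp] at hd
        exact (Nat.dvd_add_right (Dvd.intro _ rfl)).1 hd
      have hp' : p = N * (q + 1) := by rw [hp, hrN']; ring
      -- All weights equal 1 when N ∣ p, and the indices j are symmetric about 0.
      have hT : ∑ m ∈ Finset.range N, I * (2 * (m : ℂ) - ((N : ℂ) - 1)) *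
          (stepExp N ((Real.pi : ℂ) / N) m ^ p)⁻¹ = 0 := by
        have h1 : ∀ m : ℕ, stepExp N ((Real.pi : ℂ) / N) m ^ p = 1 := by
          intro m; rw [hp', pow_mul, stepExp_pi_div_pow hN, one_pow]
        simp_rw [h1, inv_one, mul_one]
        rw [← Finset.mul_sum, sum_two_mul_sub, mul_zero]
      -- The sign in 𝓒 has exponent p/N; since N is odd it equals (-1)^p.
      have hsq : (-1 : ℂ) ^ (q + 1) = (-1) ^ p := by rw [hp', pow_mul, hN.neg_one_pow]
      rw [if_pos hd, hT, herglotzC_of_dvd hN0 hp', hcpow, hlog, herglotzZetaSum_eq, hsq]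
      generalize exp (-(log (x / (2 * (Real.pi : ℂ))) / N)) ^ (2 * p) = η at hη ⊢
      generalize (-1 : ℂ) ^ p = s at hsgn ⊢
      have key : ∀ A B C : ℂ, s * -1 * N * η * (A + (2 * s / N * η⁻¹ * B + C)) =
          -(s * N * η) * (A + C) - 2 * (s * s) * B := by
        intro A B C
        field_simp
        ring
      have hL : (N : ℂ) * (2 * Real.eulerMascheroniConstant -
          2 * log (x / (2 * (Real.pi : ℂ))) / N) =
          2 * N * Real.eulerMascheroniConstant - 2 * log (x / (2 * (Real.pi : ℂ))) := by
        field_simp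
      rw [key, hsgn, hL, div_mul_cancel₀ _ hNC]
      ring
    · rw [if_neg hd, sum_mul_stepExp hN hd, herglotzC_of_not_dvd hN0 hrN hp hd, hcpow,
        herglotzZetaSum_eq]
      have hsin := sin_pi_mul_div_ne_zero hN0 (l := p) (by exact_mod_cast hd)
      rw [Int.cast_natCast] at hsin
      generalize exp (-(log (x / (2 * (Real.pi : ℂ))) / N)) ^ (2 * p) = η at hη ⊢
      generalize (-1 : ℂ) ^ p = s at hsgn ⊢
      have key : ∀ A B C : ℂ, s * -1 * N * η *
          (A + (-(B / (N * sin ((Real.pi : ℂ) * p / N)) * η⁻¹) + C)) =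
          -(s * N * η) * (A + C) + s * B / sin ((Real.pi : ℂ) * p / N) := by
        intro A B C
        field_simp
        ring
      have hT : (Real.pi : ℂ) / N * -(N * s / sin ((Real.pi : ℂ) * p / N)) =
          -(Real.pi * s / sin ((Real.pi : ℂ) * p / N)) := by
        field_simp
      rw [key, hT]
      ring
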